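/- Let $G=(V,E)$ be a finite connected graph. An $(a,b)$-ruling set of a graph is a set of nodes $U$ such that any two distinct nodes of $U$ are at distance at least $a$ and every node outside $U$ is within distance $b$ of $U$; an MIS is an inclusion-maximal independent set. For sets $\alpha,\beta\subseteq V$ and a property $P$ of subsets of $V$, an $(\alpha,\beta,P)$-reconfiguration schedule of length $\ell$ is a sequence $S_0,\dots,S_\ell$ of subsets of $V$ with $S_0=\alpha$, $S_\ell=\beta$, such that $S_i$ satisfies $P$ for every $0<i<\ell$, and the symmetric difference $S_i\oplus S_{i-1}$ is an independent set of $G$ for every $0<i\le\ell$. Let $P$ be the property of being a $(2,4)$-ruling set (i.e. independent and 4-dominating). If $G$ has diameter greater than $3$ and $\alpha,\beta$ are two MIS of $G$, then there is an $(\alpha,\beta,P)$-reconfiguration schedule of length $28$. Moreover, such a schedule can be found in $O(\mathtt{MIS}+\mathtt{R32})$ rounds of the LOCAL model (synchronous message passing between neighbors, with unbounded messages and unbounded local computation). Precisely: for $n,N\ge 0$ consider networks with $n$ nodes that have distinct identifiers in $\{1,\dots,N\}$, where $n$ and $N$ are known to the nodes. Let $\mathtt{MIS}(n,N)$ and $\mathtt{R32}(n,N)$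 be the least number of rounds in which a deterministic algorithm finds an MIS, respectively a $(3,2)$-ruling set, in every graph of this kind (connected or not), and let $\mathtt{REC}(n,N)$ be the least number of rounds in which a deterministic algorithm, in every such graph that is connected and has diameter greater than $3$, and for all MIS $\alpha,\beta$, where each node is told whether it belongs to $\alpha$ and to $\beta$, lets each node $v$ output the set of indices $i\in\{0,\dots,28\}$ with $v\in S_i$, for an $(\alpha,\beta,P)$-reconfiguration schedule $S_0,\dots,S_{28}$. Then there is a universal constant $C$ such that for all $n$ and $N$ $$\mathtt{REC}(n,N)\le C\,(\mathtt{MIS}(n,N)+\mathtt{R32}(n,N)).$$ The same holds for randomized algorithms: if $\mathtt{MIS}_\delta$, $\mathtt{R32}_\delta$, $\mathtt{REC}_\delta$ denote the corresponding complexities for algorithms in which the nodes have independent, identically distributed private random tapes and the output is incorrect with probability at most $\delta$ on each instance, then $\mathtt{REC}_{C\delta}(n,N)\le C\,(\mathtt{MIS}_\delta(n,N)+\mathtt{R32}_\delta(n,N))$ for all $n$, $N$ and $\delta\ge 0$. -/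

import Mathlib

open MeasureTheory
open scoped ENNReal

namespace MISReconfig

section Graphs

/-- `S` is an `(a, b)`-ruling set of `G`: any two distinct nodes of `S` are at distance at least `a`,
and every node outside `S` is within distance `b` of `S`. Distances are extended, so that nodes in
different connected components are at distance `⊤`. -/
def IsRulingSet {V : Type*} (G : SimpleGraph V) (a b : ℕ) (S : Set V) : Prop :=
  (∀ u ∈ S, ∀ v ∈ S, u ≠ v → (a : ℕ∞) ≤ G.edist u v) ∧
    ∀ v, v ∉ S → ∃ u ∈ S, G.edist v u ≤ (b : ℕ∞)

/-- Maximal independent sets (maximal with respect to inclusion). -/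
def IsMIS {V : Type*} (G : SimpleGraph V) (S : Set V) : Prop :=
  Maximal (fun T : Set V => G.IsIndepSet T) S

/-- `S 0, …, S ℓ` is an `(α, β, P)`-reconfiguration schedule of length `ℓ` for the graph `G`, where
`P` is a property of a graph with a distinguished set of nodes. -/
structure IsReconfigurationSchedule {V : Type*} (G : SimpleGraph V)
    (P : SimpleGraph V → Set V → Prop) (α β : Set V) (ℓ : ℕ) (S : Fin (ℓ + 1) → Set V) : Prop where
  start : S 0 = α
  finish : S (Fin.last ℓ) = β
  property : ∀ i : Fin (ℓ + 1), 0 < i → i < Fin.last ℓ → P G (S i)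
  step : ∀ i : Fin ℓ, G.IsIndepSet (symmDiff (S i.succ) (S i.castSucc))

end Graphs

section Local

/-- A deterministic algorithm in the LOCAL model: synchronous message passing with unbounded
messages and unbounded local computation. A node starts with its identifier (in `ID`) and its
input (in `I`); the output (in `O`) is read off its state. Identifiers label the links: `send s j`
is the message that a node in state `s` sends to its neighbor `j`, if it has such a neighbor, and
`recv s m` is the new state of a node in state `s` when `m` is the set of all pairs
(identifier of a neighbor, message received from it). -/
structure LocalAlgorithm (ID I O : Type) where
  State : Type
  Msg : Type
  init : ID → I → State
  send : State → ID → Msg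
  recv : State → Set (ID × Msg) → State
  output : State → O

/-- The state of each node after `t` rounds on the network `G` with identifiers `ident` and
inputs `inp`. -/
def LocalAlgorithm.stateAfter {ID I O V : Type} (A : LocalAlgorithm ID I O) (G : SimpleGraph V)
    (ident : V → ID) (inp : V → I) : ℕ → V → A.State
  | 0 => fun v => A.init (ident v) (inp v)
  | t + 1 => fun v => A.recv (A.stateAfter G ident inp t v)
      {p | ∃ u, G.Adj v u ∧ p = (ident u, A.send (A.stateAfter G ident inp t u) (ident v))}

/-- The output of each node after `T` rounds. -/
def LocalAlgorithm.run {ID I O V : Type} (A : LocalAlgorithm ID I O) (G : SimpleGraph V)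
    (ident : V → ID) (inp : V → I) (T : ℕ) (v : V) : O :=
  A.output (A.stateAfter G ident inp T v)

/-- A distributed problem with node inputs in `I` and node outputs in `O`: the instances on which
an algorithm has to work, and the outputs that are correct on an instance. -/
structure DistributedProblem (I O : Type) where
  Instance : ∀ {n : ℕ}, SimpleGraph (Fin n) → (Fin n → I) → Prop
  Correct : ∀ {n : ℕ}, SimpleGraph (Fin n) → (Fin n → I) → (Fin n → O) → Prop

variable {I O : Type}

/-- The problem can be solved deterministically in `T` rounds on all instances with `n` nodes that
have distinct identifiers from a space of `N` identifiers. The algorithm may depend on `n` and `N`,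
i.e. these are known to the nodes. -/
def SolvableIn (Q : DistributedProblem I O) (n N T : ℕ) : Prop :=
  ∃ A : LocalAlgorithm (Fin N) I O,
    ∀ (G : SimpleGraph (Fin n)) (ident : Fin n ↪ Fin N) (inp : Fin n → I),
      Q.Instance G inp → Q.Correct G inp (A.run G ident inp T)

/-- The (deterministic, worst-case) round complexity. -/
noncomputable def complexity (Q : DistributedProblem I O) (n N : ℕ) : ℕ∞ :=
  ⨅ (T : ℕ) (_ : SolvableIn Q n N T), (T : ℕ∞)

/-- As `SolvableIn`, for randomized algorithms: the nodes draw private random tapes independently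
from a distribution `μ`, and on each instance the output is incorrect with probability at
most `δ`. -/
def RandSolvableIn (Q : DistributedProblem I O) (δ : ℝ≥0∞) (n N T : ℕ) : Prop :=
  ∃ (Ω : Type) (_ : MeasurableSpace Ω) (μ : Measure Ω) (_ : IsProbabilityMeasure μ)
    (A : LocalAlgorithm (Fin N) (I × Ω) O),
    ∀ (G : SimpleGraph (Fin n)) (ident : Fin n ↪ Fin N) (inp : Fin n → I), Q.Instance G inp →
      Measure.pi (fun _ : Fin n => μ)
        {ω | ¬ Q.Correct G inp (A.run G ident (fun v => (inp v, ω v)) T)} ≤ δ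

/-- The round complexity for randomized algorithms with failure probability at most `δ`. -/
noncomputable def randComplexity (Q : DistributedProblem I O) (δ : ℝ≥0∞) (n N : ℕ) : ℕ∞ :=
  ⨅ (T : ℕ) (_ : RandSolvableIn Q δ n N T), (T : ℕ∞)

end Local

section Problems

/-- Finding a maximal independent set in an arbitrary graph; each node outputs whether it belongs
to the set. -/
def misProblem : DistributedProblem Unit Bool where
  Instance _ _ := True
  Correct G _ out := IsMIS G {v | out v = true}

/-- Finding an `(a, b)`-ruling set in an arbitrary graph. -/
def rulingSetProblem (a b : ℕ) : DistributedProblem Unit Bool where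
  Instance _ _ := True
  Correct G _ out := IsRulingSet G a b {v | out v = true}

/-- Finding a reconfiguration schedule of length `ℓ` through `(2, 4)`-ruling sets, on connected
graphs of diameter greater than `3`. The inputs tell each node whether it belongs to `α` and
whether it belongs to `β`, where `α` and `β` are maximal independent sets; each node outputs to
which of the sets `S 0, …, S ℓ` it belongs. -/
def reconfigurationProblem (ℓ : ℕ) : DistributedProblem (Bool × Bool) (Fin (ℓ + 1) → Bool) where
  Instance G inp := G.Connected ∧ 3 < G.diam ∧
    IsMIS G {v | (inp v).1 = true} ∧ IsMIS G {v | (inp v).2 = true}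
  Correct G inp out := IsReconfigurationSchedule G (fun H U => IsRulingSet H 2 4 U)
    {v | (inp v).1 = true} {v | (inp v).2 = true} ℓ (fun i => {v | out v i = true})

end Problems

end MISReconfig

/-! Both $\alpha$ and $\beta$ are transformed into one sparse common set, and the second
transformation is run backwards. All consecutive sets are nested and independent (2-separated), so
every symmetric difference is independent for free; the work lies in keeping all sets 4-dominating.

Call a node of $\beta$ pairable if some nonadjacent node of $\alpha$ lies within distance 3.
Diameter greater than 3 forces a pairable node within distance 4 of every node
(`exists_pairable_near`). A maximal set $B$ of pairable nodes at pairwise distance greater than 5 is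
therefore 9-dominating, and each center $b \in B$ has an anchor in $\alpha$ within distance 3 that
is adjacent to no center (`exists_anchor`). Removing the neighbors of $B$ from $\alpha$ could push a
node to distance 1 + 1 + 3 = 5 from an anchor. Bridges $X$, halfway between centers and anchors, are
inserted first to save that one step; once compatible nodes of $\beta$ have been added, the bridges
can go and $B$ can enter, completed to an MIS. From any MIS containing $B$ one then passes to a set
grown from $B$ by five layers at distance 2, each of which lowers the domination radius by one, from
9 to 4 (`exists_near_grown`).

For the round complexity, the plan consists of eight choices, each a maximal packing inside a
locally recognizable set. Such a packing is an MIS of an auxiliary graph joining nodes at distance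
at most 5, on which an MIS algorithm is simulated with constant overhead. This gives 43 + 40 T
rounds from an MIS algorithm with T rounds, so the MIS term alone bounds the complexity; T = 0 is
treated separately. Randomized algorithms are composed by a union bound, after replacing their tapes
by finite ones whose distribution depends on the identifier, at the cost of a factor 2 in the error.
-/

namespace MISReconfig

/-! ### Distances, maximal packings and pairable nodes -/

section Combinatorics

variable {V : Type*} {G : SimpleGraph V}

/-- `u` and `v` are within distance `k`. -/
def Near (G : SimpleGraph V) (k : ℕ) (u v : V) : Prop := G.edist u v ≤ k

theorem Near.symm {k : ℕ} {u v : V} (h : Near G k u v) : Near G k v u := by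
  rwa [Near, SimpleGraph.edist_comm]

theorem Near.refl (k : ℕ) (u : V) : Near G k u u := by simp [Near]

theorem Near.mono {j k : ℕ} {u v : V} (h : Near G j u v) (hjk : j ≤ k) : Near G k u v :=
  h.trans (by exact_mod_cast hjk)

theorem Near.trans {j k : ℕ} {u v w : V} (h : Near G j u v) (h' : Near G k v w) :
    Near G (j + k) u w :=
  SimpleGraph.edist_triangle.trans ((add_le_add h h').trans (by push_cast; rfl))

theorem near_one {u v : V} : Near G 1 u v ↔ G.Adj u v ∨ u = v := by
  rw [Near, Nat.cast_one, SimpleGraph.edist_le_one_iff_adj_or_eq]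

theorem near_of_adj {u v : V} (h : G.Adj u v) : Near G 1 u v := near_one.2 (Or.inl h)

theorem near_zero {u v : V} : Near G 0 u v ↔ u = v := by
  rw [Near, Nat.cast_zero, nonpos_iff_eq_zero, SimpleGraph.edist_eq_zero_iff]

theorem near_iff_exists_walk {k : ℕ} {u v : V} :
    Near G k u v ↔ ∃ p : G.Walk u v, p.length ≤ k := by
  constructor
  · intro h
    obtain ⟨p, hp⟩ := SimpleGraph.exists_walk_of_edist_ne_top
      (ne_top_of_le_ne_top (ENat.natCast_ne_top k) h)
    rw [Near, ← hp] at h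
    exact ⟨p, by exact_mod_cast h⟩
  · rintro ⟨p, hp⟩
    exact (SimpleGraph.edist_le p).trans (by exact_mod_cast hp)

theorem Near.split {j k : ℕ} {u w : V} (h : Near G (j + k) u w) :
    ∃ v, Near G j u v ∧ Near G k v w := by
  obtain ⟨p, hp⟩ := near_iff_exists_walk.1 h
  refine ⟨p.getVert j, near_iff_exists_walk.2 ⟨p.take j, ?_⟩,
    near_iff_exists_walk.2 ⟨p.drop j, ?_⟩⟩
  · simp
  · simp; omega

theorem near_add_one {k : ℕ} {u w : V} :
    Near G (k + 1) u w ↔ Near G k u w ∨ ∃ v, G.Adj u v ∧ Near G k v w := by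
  constructor
  · intro h
    rw [add_comm] at h
    obtain ⟨v, h1, h2⟩ := h.split
    rcases near_one.1 h1 with h1 | rfl
    · exact Or.inr ⟨v, h1, h2⟩
    · exact Or.inl h2
  · rintro (h | ⟨v, h, h'⟩)
    · exact h.mono (by omega)
    · exact ((near_of_adj h).trans h').mono (by omega)

/-- The nodes within distance `k` of `S`. -/
def thickening (G : SimpleGraph V) (k : ℕ) (S : Set V) : Set V := {v | ∃ u ∈ S, Near G k v u}

/-- The nodes with a neighbor in `S`. -/
def neighbors (G : SimpleGraph V) (S : Set V) : Set V := {v | ∃ u ∈ S, G.Adj v u}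

/-- `M` is a maximal subset of `W` whose nodes are pairwise at distance greater than `k`. -/
structure IsDistMIS (G : SimpleGraph V) (k : ℕ) (W M : Set V) : Prop where
  subset : M ⊆ W
  separated : ∀ u ∈ M, ∀ v ∈ M, Near G k u v → u = v
  maximal : ∀ w ∈ W, ∃ m ∈ M, Near G k w m

theorem exists_isDistMIS [Finite V] (G : SimpleGraph V) (k : ℕ) (W : Set V) :
    ∃ M, IsDistMIS G k W M := by
  let P : Set V → Prop := fun M => M ⊆ W ∧ ∀ u ∈ M, ∀ v ∈ M, Near G k u v → u = v
  obtain ⟨M, hM⟩ := (Set.toFinite {M | P M}).exists_maximal ⟨∅, by simp [P]⟩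
  refine ⟨M, hM.1.1, hM.1.2, fun w hw => ?_⟩
  by_contra! hcon
  have hP : P (insert w M) := by
    refine ⟨Set.insert_subset hw hM.1.1, ?_⟩
    rintro u (rfl | hu) v (rfl | hv) huv
    · rfl
    · exact absurd huv (hcon v hv)
    · exact absurd huv.symm (hcon u hu)
    · exact hM.1.2 u hu v hv huv
  have := hM.2 hP (Set.subset_insert w M) (Set.mem_insert w M)
  exact hcon w this (Near.refl k w)

theorem IsMIS.indep {S : Set V} (h : IsMIS G S) : ∀ u ∈ S, ∀ v ∈ S, ¬ G.Adj u v :=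
  fun _ hu _ hv huv => h.1 hu hv huv.ne huv

theorem isIndepSet_of_forall {S : Set V} (h : ∀ u ∈ S, ∀ v ∈ S, ¬ G.Adj u v) : G.IsIndepSet S :=
  fun _ hu _ hv _ => h _ hu _ hv

theorem IsMIS.dominating {S : Set V} (h : IsMIS G S) (v : V) : ∃ s ∈ S, Near G 1 v s := by
  by_contra! hcon
  have hv : G.IsIndepSet (insert v S) := by
    apply isIndepSet_of_forall
    rintro x (rfl | hx) y (rfl | hy) hxy
    · exact hxy.ne rfl
    · exact hcon y hy (near_of_adj hxy)
    · exact hcon x hx (near_of_adj hxy.symm)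
    · exact h.indep x hx y hy hxy
  exact hcon v (h.2 hv (Set.subset_insert v S) (Set.mem_insert v S)) (Near.refl 1 v)

theorem isMIS_iff {S : Set V} : IsMIS G S ↔
    (∀ u ∈ S, ∀ v ∈ S, ¬ G.Adj u v) ∧ ∀ v, ∃ s ∈ S, Near G 1 v s := by
  refine ⟨fun h => ⟨h.indep, h.dominating⟩, fun h => ⟨isIndepSet_of_forall h.1, ?_⟩⟩
  intro T hT hST t ht
  obtain ⟨s, hs, hts⟩ := h.2 t
  rcases near_one.1 hts with hts | rfl
  · exact absurd hts (hT ht (hST hs) hts.ne)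
  · exact hs

theorem isRulingSet_of_indep_of_near {S : Set V} (b : ℕ)
    (h1 : ∀ u ∈ S, ∀ v ∈ S, ¬ G.Adj u v) (h2 : ∀ v, ∃ s ∈ S, Near G b v s) :
    IsRulingSet G 2 b S := by
  refine ⟨fun u hu v hv huv => ?_, fun v _ => h2 v⟩
  by_contra hcon
  have : Near G 1 u v := by
    have h := not_le.1 hcon
    exact Order.le_of_lt_add_one (h.trans_eq (by norm_num))
  rcases near_one.1 this with h | h
  · exact h1 u hu v hv h
  · exact huv h

/-- The nodes of `β` with a nonadjacent node of `α` within distance `3`. -/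
def pairable (G : SimpleGraph V) (α β : Set V) : Set V :=
  {b | b ∈ β ∧ ∃ a ∈ α, Near G 3 b a ∧ ¬ G.Adj b a}

/-- Suppose `b` is not pairable, and let `u`, `w` be adjacent at distances 2 and 3 from `b`. The
dominator `a₁ ∈ α` of `u` must be adjacent to `b`, while the dominator `a ∈ α` of `w` is farther
than 3 from `b`. If the dominator `b₂ ∈ β` of `u` were not pairable either, it would be adjacent to
both, and `b, a₁, b₂, a` would be a path of length 3. -/
theorem exists_pairable_of_far {α β : Set V} (hG : G.Connected) (hα : IsMIS G α) (hβ : IsMIS G β)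
    {b q : V} (hb : b ∈ β) (hq : ¬ Near G 2 b q) : ∃ b' ∈ pairable G α β, Near G 3 b b' := by
  classical
  by_cases hbp : b ∈ pairable G α β
  · exact ⟨b, hbp, Near.refl 3 b⟩
  have hadj : ∀ a ∈ α, Near G 3 b a → G.Adj b a := fun a ha h => by
    by_contra hn
    exact hbp ⟨hb, a, ha, h, hn⟩
  -- Take `w` as near to `b` as possible among the nodes beyond distance 2; its predecessor `u` on a
  -- shortest walk is within distance 2.
  obtain ⟨u, w, hu, hw, huw⟩ : ∃ u w, Near G 2 b u ∧ ¬ Near G 2 b w ∧ Near G 1 u w := by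
    have hex : ∃ K, ∃ w, Near G K b w ∧ ¬ Near G 2 b w := by
      obtain ⟨p⟩ := hG.preconnected b q
      exact ⟨p.length, q, near_iff_exists_walk.2 ⟨p, le_rfl⟩, hq⟩
    obtain ⟨w, h1, h2⟩ := Nat.find_spec hex
    obtain ⟨K, hK⟩ : ∃ K, Nat.find hex = K + 1 := Nat.exists_eq_succ_of_ne_zero fun h0 => by
      rw [h0] at h1
      exact h2 (h1.mono (by omega))
    rw [hK] at h1
    obtain ⟨u, h3, h4⟩ := h1.split
    refine ⟨u, w, ?_, h2, h4⟩
    by_contra hu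
    exact Nat.find_min hex (m := K) (by omega) ⟨u, h3, hu⟩
  have hu1 : ¬ Near G 1 b u := fun h => hw (h.trans huw)
  obtain ⟨a₁, ha₁, hua₁⟩ := hα.dominating u
  have hba₁ := hadj a₁ ha₁ (hu.trans hua₁)
  obtain ⟨a, ha, hwa⟩ := hα.dominating w
  have hba : ¬ Near G 3 b a := fun h => hw ((near_of_adj (hadj a ha h)).trans hwa.symm)
  obtain ⟨b₂, hb₂, hub₂⟩ := hβ.dominating u
  refine ⟨b₂, ?_, hu.trans hub₂⟩
  by_contra hn
  have hadj₂ : ∀ a ∈ α, Near G 3 b₂ a → G.Adj b₂ a := fun a ha h => by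
    by_contra hn'
    exact hn ⟨hb₂, a, ha, h, hn'⟩
  have h1 := hadj₂ a₁ ha₁ ((hub₂.symm.trans hua₁).mono (by omega))
  have h2 := hadj₂ a ha ((hub₂.symm.trans huw).trans hwa)
  exact hba (((near_of_adj hba₁).trans (near_of_adj h1.symm)).trans (near_of_adj h2))

/-- If the dominator `b` of `v` has a node farther than 2, the bound is 1 + 3. Otherwise everything
is within 2 of `b`, so any pairable node is within 3 of `v`; one exists because an endpoint of a
diametral pair has a dominator in `β` that is far from the other endpoint. -/
theorem exists_pairable_near {α β : Set V} (hG : G.Connected) (hd : 3 < G.diam)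
    (hα : IsMIS G α) (hβ : IsMIS G β) (v : V) : ∃ b ∈ pairable G α β, Near G 4 v b := by
  obtain ⟨b, hb, hvb⟩ := hβ.dominating v
  by_cases hq : ∃ q, ¬ Near G 2 b q
  · obtain ⟨q, hq⟩ := hq
    obtain ⟨b', hb', h⟩ := exists_pairable_of_far hG hα hβ hb hq
    exact ⟨b', hb', hvb.trans h⟩
  · push Not at hq
    have : Nonempty V := ⟨v⟩
    obtain ⟨x, y, hxy⟩ := G.exists_dist_eq_diam
    obtain ⟨b', hb', hxb'⟩ := hβ.dominating x
    have hfar : ¬ Near G 2 b' y := fun h => by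
      have h3 : Near G 3 x y := hxb'.trans h
      rw [Near, ← (hG.preconnected x y).coe_dist_eq_edist] at h3
      have : G.dist x y ≤ 3 := by exact_mod_cast h3
      omega
    obtain ⟨b'', hb'', -⟩ := exists_pairable_of_far hG hα hβ hb' hfar
    exact ⟨b'', hb'', (hvb.trans (hq b'')).mono (by omega)⟩

/-- The nodes of `α` that keep the neighborhood of `B` dominated while `B` is inserted. -/
def anchors (G : SimpleGraph V) (α B : Set V) : Set V := (α ∩ thickening G 3 B) \ neighbors G B

/-- The candidates for intermediate nodes between the anchors and `B`. -/
def bridgeCandidates (G : SimpleGraph V) (α B : Set V) : Set V :=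
  (neighbors G B ∩ thickening G 2 (anchors G α B)) \ thickening G 1 (anchors G α B)

/-- The set that remains of `α` when `X` has been inserted and the neighbors of `B` have been
removed. -/
def bridged (G : SimpleGraph V) (α B X : Set V) : Set V :=
  ((α \ neighbors G X) \ neighbors G B) ∪ X

/-- The first steps of the schedule, at the end of which `B` can be inserted. -/
def insertion (G : SimpleGraph V) (α β B X : Set V) : ℕ → Set V
  | 0 => α
  | 1 => α \ neighbors G X
  | 2 => (α \ neighbors G X) ∪ X
  | 3 => bridged G α B X
  | 4 => bridged G α B X ∪ (β \ neighbors G (bridged G α B X))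
  | _ => (bridged G α B X ∪ (β \ neighbors G (bridged G α B X))) \ X

/-- The nodes that are not dominated when `B` has been inserted. -/
def uncovered (G : SimpleGraph V) (α β B X : Set V) : Set V :=
  (thickening G 1 (insertion G α β B X 5 ∪ B))ᶜ

/-- The sets grown from `B` by the increments `J`. -/
def grown (B : Set V) (J : ℕ → Set V) : ℕ → Set V
  | 0 => B
  | i + 1 => grown B J i ∪ J i

/-- The nodes at distance exactly `2` from `T`. -/
def rim (G : SimpleGraph V) (T : Set V) : Set V := thickening G 2 T \ thickening G 1 T

/-- The `j`-th step of the replacement of a maximal independent set `S ⊇ B` by the sets grown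
from `B`: conflicting nodes are removed, and the next increment is added. -/
def replacement (G : SimpleGraph V) (B : Set V) (J : ℕ → Set V) (S : Set V) (j : ℕ) : Set V :=
  (S \ neighbors G (grown B J ((j + 1) / 2))) ∪ grown B J (j / 2)

/-- The whole schedule. -/
def schedule (G : SimpleGraph V) (α β B X C : Set V) (J : ℕ → Set V) (k : ℕ) : Set V :=
  if k ≤ 5 then insertion G α β B X k
  else if k ≤ 16 then replacement G B J (insertion G α β B X 5 ∪ B ∪ C) (k - 6)
  else if k = 17 then grown B J 5
  else replacement G B J β (28 - k)

/-- The choices on which the schedule is based. -/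
structure IsSchedulePlan (G : SimpleGraph V) (α β B X C : Set V) (J : ℕ → Set V) : Prop where
  centers : IsDistMIS G 5 (pairable G α β) B
  bridges : IsDistMIS G 1 (bridgeCandidates G α B) X
  completion : IsDistMIS G 1 (uncovered G α β B X) C
  increment : ∀ i < 5, IsDistMIS G 1 (rim G (grown B J i)) (J i)

theorem exists_isSchedulePlan [Finite V] (G : SimpleGraph V) (α β : Set V) :
    ∃ B X C J, IsSchedulePlan G α β B X C J := by
  obtain ⟨B, hB⟩ := exists_isDistMIS G 5 (pairable G α β)
  obtain ⟨X, hX⟩ := exists_isDistMIS G 1 (bridgeCandidates G α B)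
  obtain ⟨C, hC⟩ := exists_isDistMIS G 1 (uncovered G α β B X)
  choose next hnext using fun T : Set V => exists_isDistMIS G 1 (rim G T)
  -- Each increment depends on the set grown so far, so the grown sets are built first and the
  -- increments are read off from them.
  let T : ℕ → Set V := Nat.rec B fun _ T => T ∪ next T
  have hT : ∀ i, grown B (fun i => next (T i)) i = T i := by
    intro i
    induction i with
    | zero => rfl
    | succ i ih => rw [grown, ih]
  exact ⟨B, X, C, fun i => next (T i), hB, hX, hC, fun i _ => by rw [hT]; exact hnext (T i)⟩

/-! ### Growing from the centers and replacing an MIS by the grown set -/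

section Grown

variable {B : Set V} {J : ℕ → Set V}

theorem grown_mono {i j : ℕ} (h : i ≤ j) : grown B J i ⊆ grown B J j := by
  induction j, h using Nat.le_induction with
  | base => rfl
  | succ j _ ih => exact ih.trans Set.subset_union_left

theorem grown_indep (hB : ∀ u ∈ B, ∀ v ∈ B, ¬ G.Adj u v)
    (hJ : ∀ i < 5, IsDistMIS G 1 (rim G (grown B J i)) (J i)) {i : ℕ} (hi : i ≤ 5) :
    ∀ u ∈ grown B J i, ∀ v ∈ grown B J i, ¬ G.Adj u v := by
  induction i with
  | zero => exact hB
  | succ i ih =>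
    have hJi := hJ i (by omega)
    rintro u (hu | hu) v (hv | hv) huv
    · exact ih (by omega) u hu v hv huv
    · exact (hJi.subset hv).2 ⟨u, hu, near_of_adj huv.symm⟩
    · exact (hJi.subset hu).2 ⟨v, hv, near_of_adj huv⟩
    · exact huv.ne (hJi.separated u hu v hv (near_of_adj huv))

theorem exists_near_grown_of_mem_succ
    (hJ : ∀ i < 5, IsDistMIS G 1 (rim G (grown B J i)) (J i)) {i : ℕ} (hi : i < 5) {p : V}
    (hp : p ∈ grown B J (i + 1)) : ∃ q ∈ grown B J i, Near G 2 p q := by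
  rcases hp with hp | hp
  · exact ⟨p, hp, Near.refl 2 p⟩
  · exact ((hJ i hi).subset hp).1

/-- On a walk from `v` to `t`, the node `u` two steps before `t` is either already within 1 of the
grown set, or in its rim and hence within 1 of the new layer. Either way one step is gained. -/
theorem exists_near_grown (hB : ∀ v, ∃ b ∈ B, Near G 9 v b)
    (hJ : ∀ i < 5, IsDistMIS G 1 (rim G (grown B J i)) (J i)) {i : ℕ} (hi : i ≤ 5) (v : V) :
    ∃ t ∈ grown B J i, Near G (9 - i) v t := by
  induction i with
  | zero => exact hB v
  | succ i ih =>
    obtain ⟨t, ht, hvt⟩ := ih (by omega)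
    obtain ⟨k, hk⟩ : ∃ k, 9 - i = k + 2 := ⟨7 - i, by omega⟩
    rw [hk] at hvt
    obtain ⟨u, hvu, hut⟩ := hvt.split
    rw [show 9 - (i + 1) = k + 1 by omega]
    by_cases h : u ∈ thickening G 1 (grown B J i)
    · obtain ⟨t', ht', hut'⟩ := h
      exact ⟨t', Or.inl ht', hvu.trans hut'⟩
    · obtain ⟨m, hm, hum⟩ := (hJ i (by omega)).maximal u ⟨⟨t, ht, hut⟩, h⟩
      exact ⟨m, Or.inr hm, hvu.trans hum⟩

/-- A dominator `s` is removed only because of a neighbor `p` in the next grown set, and `p` is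
within 2 of the current one: 1 + 1 + 2 = 4. -/
theorem replacement_isRulingSet (hJ : ∀ i < 5, IsDistMIS G 1 (rim G (grown B J i)) (J i))
    {S : Set V} (hS : IsMIS G S) (hBS : B ⊆ S) {j : ℕ} (hj : j ≤ 10) :
    IsRulingSet G 2 4 (replacement G B J S j) := by
  have hB : ∀ u ∈ B, ∀ v ∈ B, ¬ G.Adj u v := fun u hu v hv => hS.indep u (hBS hu) v (hBS hv)
  have hsub : grown B J (j / 2) ⊆ grown B J ((j + 1) / 2) := grown_mono (by omega)
  apply isRulingSet_of_indep_of_near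
  · rintro u (hu | hu) v (hv | hv) huv
    · exact hS.indep u hu.1 v hv.1 huv
    · exact hu.2 ⟨v, hsub hv, huv⟩
    · exact hv.2 ⟨u, hsub hu, huv.symm⟩
    · exact grown_indep hB hJ (by omega) u hu v hv huv
  · intro v
    obtain ⟨s, hs, hvs⟩ := hS.dominating v
    by_cases hsn : s ∈ neighbors G (grown B J ((j + 1) / 2))
    · obtain ⟨p, hp, hsp⟩ := hsn
      obtain ⟨q, hq, hpq⟩ : ∃ q ∈ grown B J (j / 2), Near G 2 p q := by
        obtain h | h : (j + 1) / 2 = j / 2 ∨ (j + 1) / 2 = j / 2 + 1 := by omega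
        · exact ⟨p, h ▸ hp, Near.refl 2 p⟩
        · exact exists_near_grown_of_mem_succ hJ (by omega) (h ▸ hp)
      exact ⟨q, Or.inr hq, (hvs.trans (near_of_adj hsp)).trans hpq⟩
    · exact ⟨s, Or.inl ⟨hs, hsn⟩, hvs.mono (by omega)⟩

theorem neighbors_mono {S T : Set V} (h : S ⊆ T) : neighbors G S ⊆ neighbors G T :=
  fun _ ⟨u, hu, hvu⟩ => ⟨u, h hu, hvu⟩

/-- From even `j` the step only removes nodes, from odd `j` it only adds them. -/
theorem replacement_subset_or (S : Set V) (j : ℕ) :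
    replacement G B J S j ⊆ replacement G B J S (j + 1) ∨
      replacement G B J S (j + 1) ⊆ replacement G B J S j := by
  obtain h | h : (j + 1) / 2 = j / 2 ∨ (j + 1) / 2 = (j + 1 + 1) / 2 := by omega
  · right
    rw [replacement, replacement, ← h]
    exact Set.union_subset_union_left _
      (Set.sdiff_subset_sdiff_right (neighbors_mono (grown_mono (by omega))))
  · left
    rw [replacement, replacement, ← h]
    exact Set.union_subset_union_right _ (grown_mono (by omega))

theorem replacement_zero {S : Set V} (hS : IsMIS G S) (hBS : B ⊆ S) :
    replacement G B J S 0 = S := by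
  ext v
  constructor
  · rintro (hv | hv)
    exacts [hv.1, hBS hv]
  · intro hv
    exact Or.inl ⟨hv, fun ⟨u, hu, hvu⟩ => hS.indep v hv u (hBS hu) hvu⟩

end Grown

/-! ### Domination and independence along the schedule -/

section Plan

variable {α β B X C : Set V} {J : ℕ → Set V}

theorem isIndepSet_symmDiff_of_subset_or {S T : Set V} (hS : ∀ u ∈ S, ∀ v ∈ S, ¬ G.Adj u v)
    (hT : ∀ u ∈ T, ∀ v ∈ T, ¬ G.Adj u v) (h : S ⊆ T ∨ T ⊆ S) :
    G.IsIndepSet (symmDiff T S) := by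
  apply isIndepSet_of_forall
  have key : symmDiff T S ⊆ T ∨ symmDiff T S ⊆ S := by
    rcases h with h | h
    · exact Or.inl fun x hx => hx.elim (·.1) (h ·.1)
    · exact Or.inr fun x hx => hx.elim (h ·.1) (·.1)
  intro u hu v hv
  rcases key with h | h
  · exact hT u (h hu) v (h hv)
  · exact hS u (h hu) v (h hv)

theorem IsRulingSet.indep {b : ℕ} {S : Set V} (h : IsRulingSet G 2 b S) :
    ∀ u ∈ S, ∀ v ∈ S, ¬ G.Adj u v := by
  intro u hu v hv huv
  have h2 := h.1 u hu v hv huv.ne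
  rw [SimpleGraph.edist_eq_one_iff_adj.2 huv] at h2
  exact absurd h2 (by decide)

namespace IsSchedulePlan

theorem centers_subset (h : IsSchedulePlan G α β B X C J) : B ⊆ β := fun _ hb =>
    (h.centers.subset hb).1

theorem exists_near_centers (h : IsSchedulePlan G α β B X C J) (hG : G.Connected) (hd : 3 < G.diam)
    (hα : IsMIS G α)
    (hβ : IsMIS G β) (v : V) : ∃ b ∈ B, Near G 9 v b := by
  obtain ⟨b', hb', hvb'⟩ := exists_pairable_near hG hd hα hβ v
  obtain ⟨b, hb, hb'b⟩ := h.centers.maximal b' hb'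
  exact ⟨b, hb, hvb'.trans hb'b⟩

/-- The partner of `b` is not adjacent to any other center, since that center would be within 3 + 1
of `b`, against the separation of `B`. -/
theorem exists_anchor (h : IsSchedulePlan G α β B X C J) {b : V} (hb : b ∈ B) :
    ∃ a ∈ anchors G α B, Near G 3 b a := by
  obtain ⟨-, a, ha, hba, hn⟩ := h.centers.subset hb
  refine ⟨a, ⟨⟨ha, b, hb, hba.symm⟩, ?_⟩, hba⟩
  rintro ⟨b', hb', hab'⟩
  obtain rfl := h.centers.separated b hb b' hb' ((hba.trans (near_of_adj hab')).mono (by omega))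
  exact hn hab'.symm

/-- If the nearest anchor is at distance 3, the first node `x` on the way to it is a bridge
candidate. A bridge within 1 of `x` is adjacent to some center, which is within 3 of `b` and thus
equals `b`. -/
theorem anchor_or_bridge (h : IsSchedulePlan G α β B X C J) {b : V} (hb : b ∈ B) :
    (∃ a ∈ anchors G α B, Near G 2 b a) ∨ ∃ x ∈ X, G.Adj b x := by
  by_cases h2 : ∃ a ∈ anchors G α B, Near G 2 b a
  · exact Or.inl h2
  right
  obtain ⟨a, ha, hba⟩ := h.exists_anchor hb
  obtain ⟨x, hbx, hxa⟩ := Near.split (j := 1) (k := 2) hba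
  rcases near_one.1 hbx with hbx' | rfl
  · have hx : x ∈ bridgeCandidates G α B := by
      refine ⟨⟨⟨b, hb, hbx'.symm⟩, a, ha, hxa⟩, ?_⟩
      rintro ⟨a', ha', hxa'⟩
      exact h2 ⟨a', ha', hbx.trans hxa'⟩
    obtain ⟨x', hx', hxx'⟩ := h.bridges.maximal x hx
    obtain ⟨⟨⟨b', hb', hxb'⟩, -⟩, -⟩ := h.bridges.subset hx'
    obtain rfl := h.centers.separated b hb b' hb'
      (((hbx.trans hxx').trans (near_of_adj hxb')).mono (by omega))
    exact ⟨x', hx', hxb'.symm⟩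
  · exact absurd ⟨a, ha, hxa⟩ h2

theorem anchors_subset_remaining (h : IsSchedulePlan G α β B X C J) :
    anchors G α B ⊆ (α \ neighbors G X) \ neighbors G B := by
  intro a ha
  refine ⟨⟨ha.1.1, ?_⟩, ha.2⟩
  rintro ⟨x, hx, hax⟩
  exact (h.bridges.subset hx).2 ⟨a, ha, near_of_adj hax.symm⟩

theorem anchor_notMem_bridges (h : IsSchedulePlan G α β B X C J) {a : V} (ha : a ∈ anchors G α B) :
    a ∉ X :=
  fun hx => (h.bridges.subset hx).2 ⟨a, ha, Near.refl 1 a⟩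

theorem exists_anchor_near_bridge (h : IsSchedulePlan G α β B X C J) {x : V} (hx : x ∈ X) :
    ∃ a ∈ anchors G α B, Near G 2 x a :=
  (h.bridges.subset hx).1.2

theorem bridges_indep (h : IsSchedulePlan G α β B X C J) : ∀ u ∈ X, ∀ v ∈ X, ¬ G.Adj u v :=
    fun u hu v hv huv =>
  huv.ne (h.bridges.separated u hu v hv (near_of_adj huv))

theorem insertion_two_indep (h : IsSchedulePlan G α β B X C J) (hα : IsMIS G α) :
    ∀ u ∈ insertion G α β B X 2, ∀ v ∈ insertion G α β B X 2, ¬ G.Adj u v := by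
  rintro u (hu | hu) v (hv | hv) huv
  · exact hα.indep u hu.1 v hv.1 huv
  · exact hu.2 ⟨v, hv, huv⟩
  · exact hv.2 ⟨u, hu, huv.symm⟩
  · exact h.bridges_indep u hu v hv huv

/-- Anchors survive, as bridges keep away from them. A removed dominator is adjacent to a bridge,
which is within 2 of an anchor: 1 + 1 + 2 = 4. -/
theorem insertion_one_near (h : IsSchedulePlan G α β B X C J) (hα : IsMIS G α) (v : V) :
    ∃ s ∈ insertion G α β B X 1, Near G 4 v s := by
  obtain ⟨s, hs, hvs⟩ := hα.dominating v
  by_cases hsX : s ∈ neighbors G X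
  · obtain ⟨x, hx, hsx⟩ := hsX
    obtain ⟨a, ha, hxa⟩ := h.exists_anchor_near_bridge hx
    exact ⟨a, (h.anchors_subset_remaining ha).1, (hvs.trans (near_of_adj hsx)).trans hxa⟩
  · exact ⟨s, ⟨hs, hsX⟩, hvs.mono (by omega)⟩

/-- A dominator lost to a center `b` leaves `v` within 2 of `b`, and `anchor_or_bridge` supplies a
remaining node within 2 of `b`. -/
theorem insertion_three_near (h : IsSchedulePlan G α β B X C J) (hα : IsMIS G α) (v : V) :
    ∃ s ∈ insertion G α β B X 3, Near G 4 v s := by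
  obtain ⟨s, hs, hvs⟩ := hα.dominating v
  by_cases hsX : s ∈ neighbors G X
  · obtain ⟨x, hx, hsx⟩ := hsX
    exact ⟨x, Or.inr hx, (hvs.trans (near_of_adj hsx)).mono (by omega)⟩
  by_cases hsB : s ∈ neighbors G B
  · obtain ⟨b, hb, hsb⟩ := hsB
    rcases h.anchor_or_bridge hb with ⟨a, ha, hba⟩ | ⟨x, hx, hbx⟩
    · exact ⟨a, Or.inl (h.anchors_subset_remaining ha), (hvs.trans (near_of_adj hsb)).trans hba⟩
    · exact ⟨x, Or.inr hx,
        ((hvs.trans (near_of_adj hsb)).trans (near_of_adj hbx)).mono (by omega)⟩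
  · exact ⟨s, Or.inl ⟨⟨hs, hsX⟩, hsB⟩, hvs.mono (by omega)⟩

theorem insertion_four_indep (h : IsSchedulePlan G α β B X C J) (hα : IsMIS G α) (hβ : IsMIS G β) :
    ∀ u ∈ insertion G α β B X 4, ∀ v ∈ insertion G α β B X 4, ¬ G.Adj u v := by
  have h3 : insertion G α β B X 3 ⊆ insertion G α β B X 2 :=
    Set.union_subset_union_left _ Set.sdiff_subset
  rintro u (hu | hu) v (hv | hv) huv
  · exact h.insertion_two_indep hα u (h3 hu) v (h3 hv) huv
  · exact hv.2 ⟨u, hu, huv.symm⟩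
  · exact hu.2 ⟨v, hv, huv⟩
  · exact hβ.indep u hu.1 v hv.1 huv

/-- Before the bridges are removed, every `v` is within 2 of the set: its dominator in `β` is
present or blocked by a neighbor that is. If the node found is a bridge, an anchor within 2 of it
takes over. -/
theorem insertion_five_near (h : IsSchedulePlan G α β B X C J) (hβ : IsMIS G β) (v : V) :
    ∃ s ∈ insertion G α β B X 5, Near G 4 v s := by
  obtain ⟨s, hs, hvs⟩ := hβ.dominating v
  have hX : ∀ x ∈ X, Near G 2 v x → ∃ s ∈ insertion G α β B X 5, Near G 4 v s := by
    intro x hx hvx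
    obtain ⟨a, ha, hxa⟩ := h.exists_anchor_near_bridge hx
    exact ⟨a, ⟨Or.inl (Or.inl (h.anchors_subset_remaining ha)), h.anchor_notMem_bridges ha⟩,
      hvx.trans hxa⟩
  by_cases hsn : s ∈ neighbors G (bridged G α B X)
  · obtain ⟨t, ht, hst⟩ := hsn
    have hvt : Near G 2 v t := hvs.trans (near_of_adj hst)
    by_cases htX : t ∈ X
    · exact hX t htX hvt
    · exact ⟨t, ⟨Or.inl ht, htX⟩, hvt.mono (by omega)⟩
  · by_cases hsX : s ∈ X
    · exact hX s hsX (hvs.mono (by omega))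
    · exact ⟨s, ⟨Or.inr ⟨hs, hsn⟩, hsX⟩, hvs.mono (by omega)⟩

theorem insertion_five_centers_indep (h : IsSchedulePlan G α β B X C J) (hα : IsMIS G α)
    (hβ : IsMIS G β) :
    ∀ u ∈ insertion G α β B X 5 ∪ B, ∀ v ∈ insertion G α β B X 5 ∪ B, ¬ G.Adj u v := by
  have key : ∀ u ∈ insertion G α β B X 5, ∀ b ∈ B, ¬ G.Adj u b := by
    rintro u ⟨(hu | hu) | hu, huX⟩ b hb hub
    · exact hu.2 ⟨b, hb, hub⟩
    · exact huX hu
    · exact hβ.indep u hu.1 b (h.centers_subset hb) hub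
  rintro u (hu | hu) v (hv | hv) huv
  · exact h.insertion_four_indep hα hβ u hu.1 v hv.1 huv
  · exact key u hu v hv huv
  · exact key v hv u hu huv.symm
  · exact hβ.indep u (h.centers_subset hu) v (h.centers_subset hv) huv

theorem isMIS_completion (h : IsSchedulePlan G α β B X C J) (hα : IsMIS G α) (hβ : IsMIS G β) :
    IsMIS G (insertion G α β B X 5 ∪ B ∪ C) := by
  rw [isMIS_iff]
  constructor
  · rintro u (hu | hu) v (hv | hv) huv
    · exact h.insertion_five_centers_indep hα hβ u hu v hv huv
    · exact h.completion.subset hv ⟨u, hu, near_of_adj huv.symm⟩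
    · exact h.completion.subset hu ⟨v, hv, near_of_adj huv⟩
    · exact huv.ne (h.completion.separated u hu v hv (near_of_adj huv))
  · intro v
    by_cases hv : v ∈ uncovered G α β B X
    · obtain ⟨m, hm, hvm⟩ := h.completion.maximal v hv
      exact ⟨m, Or.inr hm, hvm⟩
    · obtain ⟨s, hs, hvs⟩ := Set.notMem_compl_iff.1 hv
      exact ⟨s, Or.inl hs, hvs⟩

theorem insertion_isRulingSet (h : IsSchedulePlan G α β B X C J) (hα : IsMIS G α) (hβ : IsMIS G β)
    {k : ℕ} (hk : k ≤ 5) :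
    IsRulingSet G 2 4 (insertion G α β B X k) := by
  have h3 : insertion G α β B X 3 ⊆ insertion G α β B X 2 :=
    Set.union_subset_union_left _ Set.sdiff_subset
  obtain rfl | rfl | rfl | rfl | rfl | rfl : k = 0 ∨ k = 1 ∨ k = 2 ∨ k = 3 ∨ k = 4 ∨ k = 5 := by
    omega
  · exact isRulingSet_of_indep_of_near _ hα.indep fun v =>
      (hα.dominating v).imp fun _ hs => ⟨hs.1, hs.2.mono (by omega)⟩
  · exact isRulingSet_of_indep_of_near _ (fun u hu v hv => hα.indep u hu.1 v hv.1)
      (h.insertion_one_near hα)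
  · exact isRulingSet_of_indep_of_near _ (h.insertion_two_indep hα) fun v =>
      (h.insertion_one_near hα v).imp fun _ hs => ⟨Or.inl hs.1, hs.2⟩
  · exact isRulingSet_of_indep_of_near _
      (fun u hu v hv => h.insertion_two_indep hα u (h3 hu) v (h3 hv)) (h.insertion_three_near hα)
  · exact isRulingSet_of_indep_of_near _ (h.insertion_four_indep hα hβ) fun v =>
      (h.insertion_three_near hα v).imp fun _ hs => ⟨Or.inl hs.1, hs.2⟩
  · exact isRulingSet_of_indep_of_near _
      (fun u hu v hv => h.insertion_four_indep hα hβ u hu.1 v hv.1) (h.insertion_five_near hβ)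

theorem insertion_subset_or {k : ℕ} (hk : k < 5) :
    insertion G α β B X k ⊆ insertion G α β B X (k + 1) ∨
      insertion G α β B X (k + 1) ⊆ insertion G α β B X k := by
  obtain rfl | rfl | rfl | rfl | rfl : k = 0 ∨ k = 1 ∨ k = 2 ∨ k = 3 ∨ k = 4 := by omega
  · exact Or.inr Set.sdiff_subset
  · exact Or.inl Set.subset_union_left
  · exact Or.inr (Set.union_subset_union_left _ Set.sdiff_subset)
  · exact Or.inl Set.subset_union_left
  · exact Or.inr Set.sdiff_subset

theorem schedule_isRulingSet (h : IsSchedulePlan G α β B X C J) (hG : G.Connected) (hd : 3 < G.diam)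
    (hα : IsMIS G α)
    (hβ : IsMIS G β) (k : ℕ) (hk : k ≤ 28) : IsRulingSet G 2 4 (schedule G α β B X C J k) := by
  unfold schedule
  split_ifs with h1 h2 h3
  · exact h.insertion_isRulingSet hα hβ h1
  · exact replacement_isRulingSet h.increment (h.isMIS_completion hα hβ)
      (Set.subset_union_right.trans Set.subset_union_left) (by omega)
  · exact isRulingSet_of_indep_of_near _
      (grown_indep (fun u hu v hv => hβ.indep u (h.centers_subset hu) v (h.centers_subset hv))
        h.increment le_rfl)
      (exists_near_grown (h.exists_near_centers hG hd hα hβ) h.increment le_rfl)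
  · exact replacement_isRulingSet h.increment hβ h.centers_subset (by omega)

/-- At 16 and at 18 all five layers are present, so `grown B J 5` at 17 is contained in both
neighbors. From 18 on the replacement of `β` runs backwards, which swaps the two inclusions. -/
theorem schedule_subset_or (h : IsSchedulePlan G α β B X C J) (hα : IsMIS G α) (hβ : IsMIS G β)
    (k : ℕ) (hk : k < 28) :
    schedule G α β B X C J k ⊆ schedule G α β B X C J (k + 1) ∨
      schedule G α β B X C J (k + 1) ⊆ schedule G α β B X C J k := by
  have hcases : k < 5 ∨ k = 5 ∨ (6 ≤ k ∧ k < 16) ∨ k = 16 ∨ k = 17 ∨ 18 ≤ k := by omega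
  rcases hcases with h1 | rfl | ⟨h1, h2⟩ | rfl | rfl | h1
  · simp only [schedule, if_pos (show k ≤ 5 by omega), if_pos (show k + 1 ≤ 5 by omega)]
    exact insertion_subset_or h1
  · left
    simp only [schedule, if_true, le_refl, show ¬ 5 + 1 ≤ 5 by omega, if_false,
      show 5 + 1 ≤ 16 by omega, show 5 + 1 - 6 = 0 by omega]
    rw [replacement_zero (h.isMIS_completion hα hβ)
      (Set.subset_union_right.trans Set.subset_union_left), Set.union_assoc]
    exact Set.subset_union_left
  · obtain ⟨j, rfl⟩ : ∃ j, k = j + 6 := ⟨k - 6, by omega⟩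
    simp only [schedule, if_neg (show ¬ j + 6 ≤ 5 by omega),
      if_neg (show ¬ j + 6 + 1 ≤ 5 by omega), if_pos (show j + 6 ≤ 16 by omega),
      if_pos (show j + 6 + 1 ≤ 16 by omega), show j + 6 - 6 = j by omega,
      show j + 6 + 1 - 6 = j + 1 by omega]
    exact replacement_subset_or _ j
  · right
    exact Set.subset_union_right
  · left
    exact Set.subset_union_right
  · obtain ⟨j, hj⟩ : ∃ j, 28 - k = j + 1 := ⟨27 - k, by omega⟩
    simp only [schedule, if_neg (show ¬ k ≤ 5 by omega), if_neg (show ¬ k + 1 ≤ 5 by omega),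
      if_neg (show ¬ k ≤ 16 by omega), if_neg (show ¬ k + 1 ≤ 16 by omega),
      if_neg (show ¬ k = 17 by omega), if_neg (show ¬ k + 1 = 17 by omega), hj,
      show 28 - (k + 1) = j by omega]
    exact (replacement_subset_or β j).symm

theorem isReconfigurationSchedule (h : IsSchedulePlan G α β B X C J) (hG : G.Connected)
    (hd : 3 < G.diam) (hα : IsMIS G α) (hβ : IsMIS G β) :
    IsReconfigurationSchedule G (fun H U => IsRulingSet H 2 4 U) α β 28
      (fun i => schedule G α β B X C J i) where
  start := by simp [schedule, insertion]
  finish := replacement_zero hβ h.centers_subset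
  property i _ _ := h.schedule_isRulingSet hG hd hα hβ i (by omega)
  step i := by
    have h1 := (h.schedule_isRulingSet hG hd hα hβ i (by omega)).indep
    have h2 := (h.schedule_isRulingSet hG hd hα hβ (i + 1) (by omega)).indep
    exact isIndepSet_symmDiff_of_subset_or h1 h2 (h.schedule_subset_or hα hβ i i.2)

end IsSchedulePlan

end Plan

end Combinatorics

/-! ### Local maps, simulation on auxiliary graphs, and algorithms -/

section Locality

/-- What a node can know after `r` rounds if nodes start with data in `D` and always tell their
neighbors all they know. -/
def View (D : Type) : ℕ → Type
  | 0 => D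
  | r + 1 => View D r × Set (View D r)

/-- The view of a node after `r` rounds. -/
def view {V D : Type} (G : SimpleGraph V) (d : V → D) : ∀ r, V → View D r
  | 0, v => d v
  | r + 1, v => (view G d r v, {w | ∃ u, G.Adj v u ∧ w = view G d r u})

/-- Maps that assign an output to each node of a network with identifiers and inputs. -/
abbrev NetworkMap (n N : ℕ) (I O : Type) : Type :=
  SimpleGraph (Fin n) → (Fin n ↪ Fin N) → (Fin n → I) → Fin n → O

/-- The output of each node is determined by its view after `r` rounds. -/
def IsLocal {n N : ℕ} {I O : Type} (r : ℕ) (F : NetworkMap n N I O) : Prop :=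
  ∃ φ : View (Fin N × I) r → O, ∀ G ident inp v,
    F G ident inp v = φ (view G (fun u => (ident u, inp u)) r v)

namespace IsLocal

variable {n N r s : ℕ} {I I' O O' : Type}

theorem congr {F F' : NetworkMap n N I O} (h : IsLocal r F)
    (hF : ∀ G ident inp v, F' G ident inp v = F G ident inp v) : IsLocal r F' := by
  obtain ⟨φ, hφ⟩ := h
  exact ⟨φ, fun G ident inp v => (hF G ident inp v).trans (hφ G ident inp v)⟩

theorem succ {F : NetworkMap n N I O} (h : IsLocal r F) : IsLocal (r + 1) F := by
  obtain ⟨φ, hφ⟩ := h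
  exact ⟨fun w => φ w.1, hφ⟩

theorem mono {F : NetworkMap n N I O} (h : IsLocal r F) (hrs : r ≤ s) : IsLocal s F := by
  induction s, hrs using Nat.le_induction with
  | base => exact h
  | succ s _ ih => exact ih.succ

theorem ident : IsLocal r (fun (_ : SimpleGraph (Fin n)) (ident : Fin n ↪ Fin N)
    (_ : Fin n → I) v => ident v) :=
  mono (r := 0) ⟨fun d : Fin N × I => d.1, fun _ _ _ _ => rfl⟩ (Nat.zero_le r)

theorem input : IsLocal r (fun (_ : SimpleGraph (Fin n)) (_ : Fin n ↪ Fin N)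
    (inp : Fin n → I) v => inp v) :=
  mono (r := 0) ⟨fun d : Fin N × I => d.2, fun _ _ _ _ => rfl⟩ (Nat.zero_le r)

theorem map {F : NetworkMap n N I O} (h : IsLocal r F) (f : O → O') :
    IsLocal r (fun G ident inp v => f (F G ident inp v)) := by
  obtain ⟨φ, hφ⟩ := h
  exact ⟨fun w => f (φ w), fun G ident inp v => congrArg f (hφ G ident inp v)⟩

theorem map₂ {I₁ O₁ O₂ : Type} {F₁ : NetworkMap n N I₁ O₁} {F₂ : NetworkMap n N I₁ O₂}
    (h₁ : IsLocal r F₁) (h₂ : IsLocal r F₂) (f : O₁ → O₂ → O) :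
    IsLocal r (fun G ident inp v => f (F₁ G ident inp v) (F₂ G ident inp v)) := by
  obtain ⟨φ₁, hφ₁⟩ := h₁
  obtain ⟨φ₂, hφ₂⟩ := h₂
  exact ⟨fun w => f (φ₁ w) (φ₂ w), fun G ident inp v =>
    congrArg₂ f (hφ₁ G ident inp v) (hφ₂ G ident inp v)⟩

theorem pi {ι : Type} {F : ι → NetworkMap n N I O} (h : ∀ i, IsLocal r (F i)) :
    IsLocal r (fun G ident inp v i => F i G ident inp v) := by
  choose φ hφ using h
  exact ⟨fun w i => φ i w, fun G ident inp v => funext fun i => hφ i G ident inp v⟩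

theorem gather {F : NetworkMap n N I O} (h : IsLocal r F) :
    IsLocal (r + 1) (fun G ident inp v => {w | ∃ u, G.Adj v u ∧ w = F G ident inp u}) := by
  obtain ⟨φ, hφ⟩ := h
  refine ⟨fun w => φ '' w.2, fun G ident inp v => ?_⟩
  ext x
  simp only [hφ, view, Set.mem_image, Set.mem_ofPred_eq]
  constructor
  · rintro ⟨u, hu, rfl⟩
    exact ⟨_, ⟨u, hu, rfl⟩, rfl⟩
  · rintro ⟨_, ⟨u, hu, rfl⟩, rfl⟩
    exact ⟨u, hu, rfl⟩

theorem gather_near {F : NetworkMap n N I O} (h : IsLocal r F) (k : ℕ) :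
    IsLocal (r + k) (fun G ident inp v => {w | ∃ u, Near G k v u ∧ w = F G ident inp u}) := by
  induction k with
  | zero =>
    refine IsLocal.congr (h.map (fun w => ({w} : Set O))) fun G ident inp v => ?_
    ext w
    simp [near_zero]
  | succ k ih =>
    refine IsLocal.congr ((ih.succ).map₂ ih.gather (fun A B => A ∪ ⋃₀ B)) fun G ident inp v => ?_
    ext w
    simp only [near_add_one, Set.mem_ofPred_eq, Set.mem_union, Set.mem_sUnion]
    constructor
    · rintro ⟨u, hu | ⟨x, hx, hu⟩, rfl⟩
      · exact Or.inl ⟨u, hu, rfl⟩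
      · exact Or.inr ⟨_, ⟨x, hx, rfl⟩, u, hu, rfl⟩
    · rintro (⟨u, hu, rfl⟩ | ⟨_, ⟨x, hx, rfl⟩, u, hu, rfl⟩)
      · exact ⟨u, Or.inl hu, rfl⟩
      · exact ⟨u, Or.inr ⟨x, hx, hu⟩, rfl⟩

/-- By induction on `s`, a node can reconstruct from `r + s` rounds the `s`-round view in which the
inputs are the outputs of `F`. -/
theorem comp {F : NetworkMap n N I I'} {F' : NetworkMap n N I' O} (h : IsLocal r F)
    (h' : IsLocal s F') :
    IsLocal (r + s) (fun G ident inp v => F' G ident (F G ident inp) v) := by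
  obtain ⟨φ, hφ⟩ := h'
  have key : IsLocal (r + s) (fun G ident inp v =>
      view G (fun u => (ident u, F G ident inp u)) s v) := by
    clear hφ φ
    induction s with
    | zero => exact ident.map₂ h Prod.mk
    | succ s ih => exact ih.succ.map₂ ih.gather Prod.mk
  obtain ⟨ψ, hψ⟩ := key
  exact ⟨fun w => φ (ψ w), fun G ident inp v =>
    (hφ _ _ _ _).trans (congrArg φ (hψ G ident inp v))⟩

end IsLocal

/-- The graph on all nodes in which two distinct nodes of `W` are adjacent if their distance in `G`
is at most `k`. -/
def nearGraph {V : Type*} (G : SimpleGraph V) (k : ℕ) (W : Set V) : SimpleGraph V where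
  Adj u v := u ≠ v ∧ Near G k u v ∧ u ∈ W ∧ v ∈ W
  symm := ⟨fun _ _ h => ⟨h.1.symm, h.2.1.symm, h.2.2.2, h.2.2.1⟩⟩
  loopless := ⟨fun _ h => h.1 rfl⟩

/-- Nodes outside `W` are isolated in `nearGraph`, so they never dominate a node of `W` and can be
discarded. They are kept as vertices so that the simulated network still has exactly `n` nodes. -/
theorem IsMIS.isDistMIS {V : Type*} {G : SimpleGraph V} {k : ℕ} {W M : Set V}
    (h : IsMIS (nearGraph G k W) M) : IsDistMIS G k W (M ∩ W) where
  subset := Set.inter_subset_right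
  separated u hu v hv huv := by
    by_contra hne
    exact h.indep u hu.1 v hv.1 ⟨hne, huv, hu.2, hv.2⟩
  maximal w hw := by
    obtain ⟨m, hm, hwm⟩ := h.dominating w
    rcases near_one.1 hwm with hwm | rfl
    · exact ⟨m, ⟨hm, hwm.2.2.2⟩, hwm.2.1⟩
    · exact ⟨w, ⟨hm, hw⟩, Near.refl k w⟩

section

variable {n N r s : ℕ} {I I' O : Type}

/-- A local map can be simulated on `nearGraph`. -/
theorem IsLocal.comp_nearGraph {k T : ℕ} {F : NetworkMap n N I I'} {F' : NetworkMap n N I' O}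
    {W : SimpleGraph (Fin n) → (Fin n ↪ Fin N) → (Fin n → I) → Set (Fin n)}
    (hW : IsLocal r (fun G ident inp v => v ∈ W G ident inp)) (h : IsLocal r F)
    (h' : IsLocal T F') :
    IsLocal (r + k * T)
      (fun G ident inp v => F' (nearGraph G k (W G ident inp)) ident (F G ident inp) v) := by
  obtain ⟨φ, hφ⟩ := h'
  have key : IsLocal (r + k * T) (fun G ident inp v =>
      view (nearGraph G k (W G ident inp)) (fun u => (ident u, F G ident inp u)) T v) := by
    clear hφ φ
    induction T with
    | zero => exact IsLocal.ident.map₂ h Prod.mk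
    | succ T ih =>
      have hW' := hW.mono (Nat.le_add_right r (k * T))
      have h1 := ((IsLocal.ident.map₂ hW' Prod.mk).map₂ ih Prod.mk).gather_near k
      have h2 := (IsLocal.ident.map₂ hW' Prod.mk).mono (Nat.le_add_right (r + k * T) k)
      -- The distance-`k` ball contains the node itself; it is excluded by comparing identifiers.
      have h3 := h1.map₂ h2 fun A p => {x | p.2 ∧ ∃ i, (i, True, x) ∈
        (fun q : (Fin N × Prop) × _ => (q.1.1, q.1.2, q.2)) '' A ∧ i ≠ p.1}
      have h4 := (ih.mono (Nat.le_add_right (r + k * T) k)).map₂ h3 Prod.mk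
      rw [show r + k * (T + 1) = r + k * T + k by ring]
      refine IsLocal.congr (h4) fun G ident inp v => ?_
      refine congrArg (Prod.mk _) ?_
      ext x
      simp only [Set.mem_ofPred_eq, Set.mem_image, Prod.exists, Prod.mk.injEq, nearGraph]
      constructor
      · rintro ⟨u, ⟨huv, hnear, hv, hu⟩, rfl⟩
        exact ⟨hv, ident u, ⟨ident u, u ∈ W G ident inp, _, ⟨u, hnear, ⟨rfl, rfl⟩, rfl⟩, rfl,
          by simpa using hu, rfl⟩, fun he => huv (ident.injective he).symm⟩
      · rintro ⟨hv, i, ⟨i', p, y, ⟨u, hnear, ⟨rfl, rfl⟩, rfl⟩, rfl, hu, rfl⟩, hi⟩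
        exact ⟨u, ⟨fun he => hi (by rw [he]), hnear, hv, of_eq_true hu⟩, rfl⟩
  obtain ⟨ψ, hψ⟩ := key
  exact ⟨fun w => φ (ψ w), fun G ident inp v =>
    (hφ _ _ _ _).trans (congrArg φ (hψ G ident inp v))⟩

/-- Messages add nothing to the states: from a neighbor's state and its own identifier, the receiver
can compute the message addressed to it. -/
theorem LocalAlgorithm.isLocal_run (A : LocalAlgorithm (Fin N) I O) (T : ℕ) :
    IsLocal (n := n) T (fun G ident inp v => A.run G ident inp T v) := by
  refine IsLocal.map (F := fun G ident inp v => A.stateAfter G ident inp T v) ?_ A.output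
  induction T with
  | zero => exact IsLocal.ident.map₂ IsLocal.input A.init
  | succ T ih =>
    have h1 := (IsLocal.ident.map₂ ih Prod.mk).gather
    have h2 := (IsLocal.ident (r := T + 1)).map₂ h1 fun i (A' : Set (Fin N × A.State)) =>
      (fun q : Fin N × A.State => (q.1, A.send q.2 i)) '' A'
    refine IsLocal.congr (ih.succ.map₂ h2 A.recv) fun G ident inp v => ?_
    refine congrArg (A.recv _) ?_
    ext p
    simp only [Set.mem_ofPred_eq, Set.mem_image]
    constructor
    · rintro ⟨u, hu, rfl⟩
      exact ⟨_, ⟨u, hu, rfl⟩, rfl⟩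
    · rintro ⟨_, ⟨u, hu, rfl⟩, rfl⟩
      exact ⟨u, hu, rfl⟩

open Classical in
/-- The algorithm in which each node collects its view. -/
noncomputable def viewAlgorithm [Inhabited O] (T : ℕ) (φ : View (Fin N × I) T → O) :
    LocalAlgorithm (Fin N) I O where
  State := Σ r, View (Fin N × I) r
  Msg := Σ r, View (Fin N × I) r
  init i x := ⟨0, (i, x)⟩
  send s _ := s
  recv s m := ⟨s.1 + 1, (s.2, {w | ∃ i, (i, ⟨s.1, w⟩) ∈ m})⟩
  output s := if h : s.1 = T then φ (h ▸ s.2) else default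

/-- The round counter equals `t`, so the `default` output is never used after exactly `T` rounds. -/
theorem viewAlgorithm_stateAfter [Inhabited O] (T : ℕ) (φ : View (Fin N × I) T → O)
    (G : SimpleGraph (Fin n)) (ident : Fin n ↪ Fin N) (inp : Fin n → I) (t : ℕ) (v : Fin n) :
    (viewAlgorithm T φ).stateAfter G ident inp t v =
      ⟨t, view G (fun u => (ident u, inp u)) t v⟩ := by
  induction t generalizing v with
  | zero => rfl
  | succ t ih =>
    simp only [LocalAlgorithm.stateAfter, ih]
    simp only [viewAlgorithm, view]
    congr 2
    ext w
    simp

theorem IsLocal.exists_algorithm [Inhabited O] {T : ℕ} {F : NetworkMap n N I O}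
    (h : IsLocal T F) : ∃ A : LocalAlgorithm (Fin N) I O, ∀ (G : SimpleGraph (Fin n))
      (ident : Fin n ↪ Fin N) (inp : Fin n → I), A.run G ident inp T = F G ident inp := by
  obtain ⟨φ, hφ⟩ := h
  refine ⟨viewAlgorithm T φ, fun G ident inp => funext fun v => ?_⟩
  rw [LocalAlgorithm.run, viewAlgorithm_stateAfter, hφ]
  simp [viewAlgorithm]

end

/-! ### Locally recognizable sets -/

section LocalSets

variable {n N r : ℕ} {I : Type}

/-- A set of nodes, each of which can tell from its view after `r` rounds whether it is in the
set. -/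
def IsLocalSet (r : ℕ) (S : SimpleGraph (Fin n) → (Fin n ↪ Fin N) → (Fin n → I) → Set (Fin n)) :
    Prop :=
  IsLocal r (fun G ident inp v => v ∈ S G ident inp)

namespace IsLocalSet

variable {S S' : SimpleGraph (Fin n) → (Fin n ↪ Fin N) → (Fin n → I) → Set (Fin n)}

theorem mono {s : ℕ} (h : IsLocalSet r S) (hrs : r ≤ s) : IsLocalSet s S := IsLocal.mono h hrs

theorem union (h : IsLocalSet r S) (h' : IsLocalSet r S') :
    IsLocalSet r (fun G ident inp => S G ident inp ∪ S' G ident inp) :=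
  IsLocal.map₂ h h' Or

theorem inter (h : IsLocalSet r S) (h' : IsLocalSet r S') :
    IsLocalSet r (fun G ident inp => S G ident inp ∩ S' G ident inp) :=
  IsLocal.map₂ h h' And

theorem compl (h : IsLocalSet r S) : IsLocalSet r (fun G ident inp => (S G ident inp)ᶜ) :=
  IsLocal.map h Not

theorem diff (h : IsLocalSet r S) (h' : IsLocalSet r S') :
    IsLocalSet r (fun G ident inp => S G ident inp \ S' G ident inp) :=
  h.inter h'.compl

theorem thickening (h : IsLocalSet r S) (k : ℕ) :
    IsLocalSet (r + k) (fun G ident inp => thickening G k (S G ident inp)) := by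
  unfold IsLocalSet
  refine IsLocal.congr ((IsLocal.gather_near h k).map (fun A : Set Prop => True ∈ A))
      fun G ident inp v => ?_
  simp [MISReconfig.thickening, and_comm]

theorem neighbors (h : IsLocalSet r S) :
    IsLocalSet (r + 1) (fun G ident inp => neighbors G (S G ident inp)) := by
  unfold IsLocalSet
  refine IsLocal.congr ((IsLocal.gather h).map (fun A : Set Prop => True ∈ A))
      fun G ident inp v => ?_
  simp [MISReconfig.neighbors, and_comm]

theorem iUnion {ι : Type} {S : ι → SimpleGraph (Fin n) → (Fin n ↪ Fin N) → (Fin n → I) →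
    Set (Fin n)} (h : ∀ i, IsLocalSet r (S i)) :
    IsLocalSet r (fun G ident inp => ⋃ i, S i G ident inp) := by
  unfold IsLocalSet
  simp only [Set.mem_iUnion]
  exact (IsLocal.pi h).map fun f => ∃ i, f i

theorem of_pred (p : Fin N → I → Prop) :
    IsLocalSet (n := n) r (fun _ ident inp => {v | p (ident v) (inp v)}) :=
  IsLocal.ident.map₂ IsLocal.input p

/-- The same node `a` has to be near and nonadjacent. Identifiers single it out, which reduces the
condition to a union over identifiers of thickenings and neighborhoods. -/
theorem pairable (h : IsLocalSet r S) (h' : IsLocalSet r S') :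
    IsLocalSet (r + 3) (fun G ident inp => pairable G (S G ident inp) (S' G ident inp)) := by
  have hi : ∀ i, IsLocalSet (n := n) (I := I) r
      (fun _ (ident : Fin n ↪ Fin N) _ => {v | ident v = i}) :=
    fun i => of_pred fun j _ => j = i
  have key : IsLocalSet (r + 3) (fun G ident inp => S' G ident inp ∩ ⋃ i : Fin N,
      MISReconfig.thickening G 3 (S G ident inp ∩ {v | ident v = i}) \
        MISReconfig.neighbors G {v | ident v = i}) :=
    (h'.mono (by omega)).inter <| iUnion fun i =>
      ((h.inter (hi i)).thickening 3).diff ((hi i).neighbors.mono (by omega))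
  unfold IsLocalSet at key ⊢
  refine IsLocal.congr (key) fun G ident inp v => ?_
  simp only [MISReconfig.pairable, MISReconfig.thickening, MISReconfig.neighbors,
    eq_iff_iff, Set.mem_ofPred_eq, Set.mem_inter_iff, Set.mem_iUnion, Set.mem_sdiff]
  refine and_congr_right fun _ => ⟨?_, ?_⟩
  · rintro ⟨a, ha, hva, hn⟩
    exact ⟨ident a, ⟨a, ⟨ha, rfl⟩, hva⟩, fun ⟨u, hu, hvu⟩ => hn (ident.injective hu ▸ hvu)⟩
  · rintro ⟨i, ⟨a, ⟨ha, rfl⟩, hva⟩, hn⟩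
    exact ⟨a, ha, hva, fun hva' => hn ⟨a, rfl, hva'⟩⟩

end IsLocalSet

end LocalSets

end Locality

/-! ### Replacing tape distributions by finitely supported ones -/

section Discretization

open ProbabilityTheory

/-- The measure on `Ω` with point masses `q x` at the points `x` of a finite set. -/
noncomputable def pointMasses {Ω : Type*} [MeasurableSpace Ω] (F : Finset Ω) (q : Ω → ℝ≥0∞) :
    Measure Ω :=
  ∑ x ∈ F, q x • Measure.dirac x

theorem isProbabilityMeasure_pointMasses {Ω : Type*} [MeasurableSpace Ω] {F : Finset Ω}
    {q : Ω → ℝ≥0∞} (hq : ∑ x ∈ F, q x = 1) : IsProbabilityMeasure (pointMasses F q) := by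
  constructor
  simp [pointMasses, Measure.finsetSum_apply, hq]

theorem lintegral_pointMasses {Ω : Type*} [MeasurableSpace Ω] (F : Finset Ω) (q : Ω → ℝ≥0∞)
    {g : Ω → ℝ≥0∞} (hg : Measurable g) :
    ∫⁻ x, g x ∂(pointMasses F q) = ∑ x ∈ F, q x * g x := by
  rw [pointMasses, lintegral_finsetSum_measure]
  refine Finset.sum_congr rfl fun x _ => ?_
  rw [lintegral_smul_measure, lintegral_dirac' x hg, smul_eq_mul]

/-- Finitely many expectations can be matched, up to a factor `c > 1`, by a finitely supported
probability measure. -/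
theorem exists_pointMasses_lintegral_le {Ω ι : Type*} [MeasurableSpace Ω] [Finite ι]
    (μ : Measure Ω) [IsProbabilityMeasure μ] (h : ι → Ω → ℝ≥0∞) (hm : ∀ i, Measurable (h i))
    (hle : ∀ i x, h i x ≤ 1) {c : ℝ≥0∞} (hc : 1 < c) :
    ∃ (F : Finset Ω) (q : Ω → ℝ≥0∞), ∑ x ∈ F, q x = 1 ∧
      ∀ i, ∑ x ∈ F, q x * h i x ≤ c * ∫⁻ x, h i x ∂μ := by
  classical
  have := Fintype.ofFinite ι
  have : Nonempty Ω := nonempty_of_isProbabilityMeasure μ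
  let f : Ω → ι → ℝ := fun x i => (h i x).toReal
  have htop : ∀ i x, h i x ≠ ⊤ := fun i x => ne_top_of_le_ne_top ENNReal.one_ne_top (hle i x)
  have hI : ∀ i, ∫⁻ x, h i x ∂μ ≤ 1 := fun i => by
    calc ∫⁻ x, h i x ∂μ ≤ ∫⁻ _, 1 ∂μ := lintegral_mono (hle i)
      _ = 1 := by simp
  have hItop : ∀ i, ∫⁻ x, h i x ∂μ ≠ ⊤ := fun i => ne_top_of_le_ne_top ENNReal.one_ne_top (hI i)
  have hfi : ∀ i, Integrable (fun x => f x i) μ := fun i =>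
    integrable_toReal_of_lintegral_ne_top (hm i).aemeasurable (hItop i)
  have hint : Integrable f μ := Integrable.of_eval hfi
  have hval : ∀ i, (∫ x, f x ∂μ) i = (∫⁻ x, h i x ∂μ).toReal := fun i => by
    rw [eval_integral hfi]
    exact integral_toReal (hm i).aemeasurable (ae_of_all _ fun x => (htop i x).lt_top)
  -- A multiplicative bound has to be exact where the expectation vanishes; support points are
  -- therefore taken from this set of full measure.
  let s₀ : Set Ω := {x | ∀ i, ∫⁻ x, h i x ∂μ = 0 → h i x = 0}
  have hae : ∀ᵐ x ∂μ, f x ∈ closure (convexHull ℝ (f '' s₀)) := by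
    have : ∀ᵐ x ∂μ, x ∈ s₀ := by
      refine ae_all_iff.2 fun i => ?_
      by_cases h0 : ∫⁻ x, h i x ∂μ = 0
      · filter_upwards [(lintegral_eq_zero_iff (hm i)).1 h0] with x hx _ using hx
      · exact ae_of_all _ fun x hx => absurd hx h0
    filter_upwards [this] with x hx
    exact subset_closure (subset_convexHull ℝ _ ⟨x, hx, rfl⟩)
  have hmem := (convex_convexHull ℝ (f '' s₀)).closure.integral_mem isClosed_closure hae hint
  obtain ⟨d, hd1, hdc⟩ := ENNReal.lt_iff_exists_nnreal_btwn.1 hc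
  have hd1' : (1 : ℝ) < d := by exact_mod_cast hd1
  let a : ι → ℝ := fun i => (∫⁻ x, h i x ∂μ).toReal
  have hU : IsOpen {y : ι → ℝ | ∀ i, a i ≠ 0 → y i < d * a i} := by
    simp only [Set.ofPred_forall]
    refine isOpen_iInter_of_finite fun i => isOpen_iInter_of_finite fun _ => ?_
    exact isOpen_lt (continuous_apply i) continuous_const
  -- The vector of expectations lies in the closed convex hull of the values, so the open condition
  -- is met by an actual finite convex combination `y`.
  obtain ⟨y, hyU, hy⟩ := mem_closure_iff.1 hmem _ hU fun i hi => by
    rw [hval]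
    have : 0 < a i := lt_of_le_of_ne ENNReal.toReal_nonneg (Ne.symm hi)
    change a i < d * a i
    nlinarith
  rw [convexHull_eq_union_convexHull_finite_subsets] at hy
  simp only [Set.mem_iUnion] at hy
  obtain ⟨t, hts, hy⟩ := hy
  obtain ⟨w, hw0, hw1, hwy⟩ := Finset.mem_convexHull'.1 hy
  choose! g hg hfg using fun z (hz : z ∈ t) => hts hz
  have hinj : Set.InjOn g t := fun z hz z' hz' hzz' => by
    rw [← hfg z hz, ← hfg z' hz', hzz']
  refine ⟨t.image g, fun x => ENNReal.ofReal (w (f x)), ?_, fun i => ?_⟩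
  · rw [Finset.sum_image hinj, ← ENNReal.ofReal_one, ← hw1, ENNReal.ofReal_sum_of_nonneg hw0]
    exact Finset.sum_congr rfl fun z hz => by rw [hfg z hz]
  · rw [Finset.sum_image hinj]
    by_cases hi : a i = 0
    · have h0 : ∫⁻ x, h i x ∂μ = 0 := by
        simpa [a, ENNReal.toReal_eq_zero_iff, hItop i] using hi
      rw [Finset.sum_eq_zero fun z hz => by rw [hg z hz i h0, mul_zero]]
      exact zero_le
    · have hsum : ∑ z ∈ t, ENNReal.ofReal (w (f (g z))) * h i (g z) = ENNReal.ofReal (y i) := by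
        rw [← hwy, Finset.sum_apply, ENNReal.ofReal_sum_of_nonneg]
        · refine Finset.sum_congr rfl fun z hz => ?_
          rw [hfg z hz, Pi.smul_apply, smul_eq_mul, ENNReal.ofReal_mul (hw0 z hz)]
          congr 1
          rw [← congrFun (hfg z hz) i, ENNReal.ofReal_toReal (htop i _)]
        · intro z hz
          have : 0 ≤ z i := by
            rw [← congrFun (hfg z hz) i]
            exact ENNReal.toReal_nonneg
          exact mul_nonneg (hw0 z hz) this
      rw [hsum]
      calc ENNReal.ofReal (y i) ≤ ENNReal.ofReal (d * a i) := ENNReal.ofReal_le_ofReal (hyU i hi).le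
        _ = d * ∫⁻ x, h i x ∂μ := by
          rw [ENNReal.ofReal_mul d.coe_nonneg, ENNReal.ofReal_coe_nnreal,
              ENNReal.ofReal_toReal (hItop i)]
        _ ≤ c * ∫⁻ x, h i x ∂μ := by gcongr

/-- Restricting a product measure to some of the coordinates. -/
theorem map_pi_comp_injective {ι κ Ω : Type*} [Fintype ι] [Fintype κ] [MeasurableSpace Ω]
    (ν : ι → Measure Ω) [∀ i, IsProbabilityMeasure (ν i)] {e : κ → ι}
    (he : Function.Injective e) :
    (Measure.pi ν).map (fun x k => x (e k)) = Measure.pi (fun k => ν (e k)) := by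
  have h1 : iIndepFun (fun i (x : ι → Ω) => x i) (Measure.pi ν) :=
    iIndepFun_pi (X := fun _ x => x) fun _ => aemeasurable_id
  have h2 := h1.precomp he
  rw [iIndepFun_iff_map_fun_eq_pi_map (fun k => (measurable_pi_apply (e k)).aemeasurable)] at h2
  rw [h2]
  congr 1
  ext k : 1
  exact (measurePreserving_eval ν (e k)).map_eq

/-- Integrating out the other coordinates first shows that the expectation depends on the `j`-th
factor only through the integral of one fixed function. -/
theorem lintegral_pi_update {ι Ω : Type*} [Fintype ι] [DecidableEq ι] [MeasurableSpace Ω]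
    (ν : ι → Measure Ω) [∀ i, IsProbabilityMeasure (ν i)] (j : ι) (κ : Measure Ω)
    [IsProbabilityMeasure κ] {f : (ι → Ω) → ℝ≥0∞} (hf : Measurable f) (x : ι → Ω) :
    ∫⁻ y, f y ∂(Measure.pi (Function.update ν j κ)) =
      ∫⁻ t, (∫⋯∫⁻_(Finset.univ.erase j), f ∂ν) (Function.update x j t) ∂κ := by
  have : ∀ i, IsProbabilityMeasure (Function.update ν j κ i) := fun i => by
    by_cases h : i = j
    · subst h; simpa
    · simp only [Function.update_of_ne h]; infer_instance
  rw [lintegral_eq_lmarginal_univ x, lmarginal_erase _ hf (Finset.mem_univ j)]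
  simp only [Function.update_self]
  congr 1
  ext t
  simp only [lmarginal]
  congr 2
  ext i : 1
  exact Function.update_of_ne (Finset.ne_of_mem_erase i.2) _ _

/-- The factors are replaced one at a time, each at the cost of a factor `c`. The replacements may
differ between coordinates, so identical distribution is given up here. -/
theorem exists_pointMasses_pi {ι J Ω : Type*} [Fintype ι] [Finite J] [MeasurableSpace Ω]
    (μ : Measure Ω) [IsProbabilityMeasure μ] (f : J → (ι → Ω) → ℝ≥0∞)
    (hf : ∀ i, Measurable (f i)) (hle : ∀ i x, f i x ≤ 1) {c : ℝ≥0∞} (hc : 1 < c) :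
    ∃ (F : ι → Finset Ω) (q : ι → Ω → ℝ≥0∞), (∀ j, ∑ x ∈ F j, q j x = 1) ∧
      ∀ i, ∫⁻ y, f i y ∂(Measure.pi fun j => pointMasses (F j) (q j)) ≤
        c ^ Fintype.card ι * ∫⁻ y, f i y ∂(Measure.pi fun _ => μ) := by
  classical
  have : Nonempty Ω := nonempty_of_isProbabilityMeasure μ
  have key : ∀ s : Finset ι, ∃ (F : ι → Finset Ω) (q : ι → Ω → ℝ≥0∞),
      (∀ j, ∑ x ∈ F j, q j x = 1) ∧
      ∀ i, ∫⁻ y, f i y ∂(Measure.pi fun j => if j ∈ s then pointMasses (F j) (q j) else μ) ≤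
        c ^ s.card * ∫⁻ y, f i y ∂(Measure.pi fun _ => μ) := by
    intro s
    induction s using Finset.induction_on with
    | empty =>
      exact ⟨fun _ => {Classical.arbitrary Ω}, fun _ _ => 1, by simp, by simp⟩
    | insert j s hj ih =>
      obtain ⟨F, q, hq, hs⟩ := ih
      set ν : ι → Measure Ω := fun j => if j ∈ s then pointMasses (F j) (q j) else μ with hν
      have hprob : ∀ i, IsProbabilityMeasure (ν i) := fun i => by
        simp only [hν]
        split_ifs
        exacts [isProbabilityMeasure_pointMasses (hq i), inferInstance]
      let x₀ : ι → Ω := fun _ => Classical.arbitrary Ω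
      let g : J → Ω → ℝ≥0∞ := fun i t =>
        (∫⋯∫⁻_(Finset.univ.erase j), f i ∂ν) (Function.update x₀ j t)
      have hg : ∀ i, Measurable (g i) := fun i =>
        ((hf i).lmarginal ν).comp (measurable_update x₀)
      have hg1 : ∀ i t, g i t ≤ 1 := fun i t => by
        calc g i t ≤ (∫⋯∫⁻_(Finset.univ.erase j), (fun _ => 1) ∂ν) (Function.update x₀ j t) :=
              lmarginal_mono (fun x => hle i x) _
          _ ≤ 1 := by simp [lmarginal]
      obtain ⟨F', q', hq', hF'⟩ := exists_pointMasses_lintegral_le μ g hg hg1 hc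
      have hprob' := isProbabilityMeasure_pointMasses hq'
      refine ⟨Function.update F j F', Function.update q j q', fun i => ?_, fun i => ?_⟩
      · by_cases h : i = j
        · subst h; simpa
        · simpa [Function.update_of_ne h] using hq i
      · have h1 : (fun i => if i ∈ insert j s then
            pointMasses (Function.update F j F' i) (Function.update q j q' i) else μ) =
            Function.update ν j (pointMasses F' q') := by
          ext i : 1
          by_cases h : i = j
          · subst h; simp
          · simp [h, hν]
        have h2 : ∫⁻ y, f i y ∂(Measure.pi ν) = ∫⁻ t, g i t ∂μ := by
          have hup : Function.update ν j μ = ν := by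
            rw [Function.update_eq_self_iff]
            simp [hν, hj]
          rw [← lintegral_pi_update ν j μ (hf i) x₀, hup]
        rw [h1, lintegral_pi_update ν j _ (hf i) x₀, lintegral_pointMasses _ _ (hg i),
          Finset.card_insert_of_notMem hj, pow_succ']
        calc _ ≤ c * ∫⁻ t, g i t ∂μ := hF' i
          _ ≤ _ := by rw [← h2, mul_assoc]; gcongr; exact hs i
  obtain ⟨F, q, hq, h⟩ := key Finset.univ
  exact ⟨F, q, hq, by simpa using h⟩

end Discretization

/-! ### Randomized relations, their composition, and conversions -/

section Solvability

/-- A relation between the inputs and the outputs of the nodes of a network. -/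
abbrev NetworkRel (n N : ℕ) (I O : Type) : Type :=
  SimpleGraph (Fin n) → (Fin n ↪ Fin N) → (Fin n → I) → (Fin n → O) → Prop

open Classical in
/-- The probability of `bad`, if the tape of a node with identifier `j` is distributed according
to `p j`. -/
noncomputable def tapeProb {n N : ℕ} {Ω : Type} [Fintype Ω] (p : Fin N → Ω → ℝ≥0∞)
    (ident : Fin n ↪ Fin N) (bad : Set (Fin n → Ω)) : ℝ≥0∞ :=
  ∑ ω : Fin n → Ω, if ω ∈ bad then ∏ v, p (ident v) (ω v) else 0

/-- The relation `R` can be achieved in `r` rounds with error probability at most `δ`, with tapes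
from a finite set whose distribution may depend on the identifier. -/
def Achievable {n N : ℕ} {I O : Type} (r : ℕ) (δ : ℝ≥0∞) (R : NetworkRel n N I O) : Prop :=
  ∃ (Ω : Type) (_ : Fintype Ω) (p : Fin N → Ω → ℝ≥0∞) (F : NetworkMap n N (I × Ω) O),
    (∀ j, ∑ x, p j x = 1) ∧ IsLocal r F ∧ ∀ G ident inp,
      tapeProb p ident {ω | ¬ R G ident inp (F G ident fun v => (inp v, ω v))} ≤ δ

section

variable {n N : ℕ} {Ω : Type} [Fintype Ω]

theorem sum_prod_tape {p : Fin N → Ω → ℝ≥0∞} (hp : ∀ j, ∑ x, p j x = 1)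
    (ident : Fin n ↪ Fin N) : ∑ ω : Fin n → Ω, ∏ v, p (ident v) (ω v) = 1 := by
  classical
  rw [← Fintype.piFinset_univ, ← Finset.prod_univ_sum]
  simp [hp]

theorem tapeProb_mono (p : Fin N → Ω → ℝ≥0∞) (ident : Fin n ↪ Fin N) {A B : Set (Fin n → Ω)}
    (h : A ⊆ B) : tapeProb p ident A ≤ tapeProb p ident B := by
  refine Finset.sum_le_sum fun ω _ => ?_
  by_cases hA : ω ∈ A
  · rw [if_pos hA, if_pos (h hA)]
  · rw [if_neg hA]
    exact zero_le

theorem pi_pointMasses_apply [MeasurableSpace Ω] [MeasurableSingletonClass Ω]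
    {p : Fin N → Ω → ℝ≥0∞} (hp : ∀ j, ∑ x, p j x = 1) (ident : Fin n ↪ Fin N)
    (A : Set (Fin n → Ω)) :
    Measure.pi (fun v => pointMasses Finset.univ (p (ident v))) A = tapeProb p ident A := by
  classical
  have hprob := fun j => isProbabilityMeasure_pointMasses (hp j)
  have hsingle : ∀ j x, pointMasses Finset.univ (p j) {x} = p j x := fun j x => by
    simp [pointMasses, Measure.finsetSum_apply, Set.indicator_apply]
  calc Measure.pi (fun v => pointMasses Finset.univ (p (ident v))) A
      = ∑ ω ∈ Finset.univ.filter (· ∈ A),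
          Measure.pi (fun v => pointMasses Finset.univ (p (ident v))) {ω} := by
        rw [sum_measure_singleton]
        simp
    _ = tapeProb p ident A := by
        rw [tapeProb, Finset.sum_filter]
        refine Finset.sum_congr rfl fun ω _ => ?_
        rw [Measure.pi_singleton]
        simp only [hsingle]

end

namespace Achievable

variable {n N r s : ℕ} {I I' I'' O : Type} {δ δ' : ℝ≥0∞}

theorem imp {R R' : NetworkRel n N I O} (h : Achievable r δ R)
    (hR : ∀ G ident inp out, R G ident inp out → R' G ident inp out) : Achievable r δ R' := by
  obtain ⟨Ω, hΩ, p, F, hp, hF, hδ⟩ := h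
  refine ⟨Ω, hΩ, p, F, hp, hF, fun G ident inp => (tapeProb_mono p ident ?_).trans
    (hδ G ident inp)⟩
  exact fun ω hω hR' => hω (hR _ _ _ _ hR')

theorem mono {R : NetworkRel n N I O} (h : Achievable r δ R) (hrs : r ≤ s) :
    Achievable s δ R := by
  obtain ⟨Ω, hΩ, p, F, hp, hF, hδ⟩ := h
  exact ⟨Ω, hΩ, p, F, hp, hF.mono hrs, hδ⟩

theorem mono_error {R : NetworkRel n N I O} (h : Achievable r δ R) (hδ : δ ≤ δ') :
    Achievable r δ' R := by
  obtain ⟨Ω, hΩ, p, F, hp, hF, hR⟩ := h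
  exact ⟨Ω, hΩ, p, F, hp, hF, fun G ident inp => (hR G ident inp).trans hδ⟩

theorem of_isLocal {F : NetworkMap n N I O} (h : IsLocal r F) :
    Achievable r 0 (fun G ident inp out => out = F G ident inp) := by
  refine ⟨Unit, inferInstance, fun _ _ => 1, fun G ident inp => F G ident fun v => (inp v).1,
    by simp, ?_, fun G ident inp => by simp [tapeProb]⟩
  have := (IsLocal.input (n := n) (N := N) (I := I × Unit) (r := 0)).map Prod.fst |>.comp h
  rwa [zero_add] at this

/-- Union bound with independent tapes: the second error bound holds for every fixed intermediate
input, hence conditionally on the first tape. -/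
theorem comp {R : NetworkRel n N I I'} {R' : NetworkRel n N I' I''} (h : Achievable r δ R)
    (h' : Achievable s δ' R') :
    Achievable (r + s) (δ + δ')
      (fun G ident inp out => ∃ mid, R G ident inp mid ∧ R' G ident mid out) := by
  classical
  obtain ⟨Ω, _, p, F, hp, hF, hδ⟩ := h
  obtain ⟨Ω', _, p', F', hp', hF', hδ'⟩ := h'
  refine ⟨Ω × Ω', inferInstance, fun j x => p j x.1 * p' j x.2,
    fun G ident inp => F' G ident fun v =>
      (F G ident (fun u => ((inp u).1, (inp u).2.1)) v, (inp v).2.2), fun j => ?_, ?_,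
    fun G ident inp => ?_⟩
  · rw [Fintype.sum_prod_type]
    simp only [← Finset.mul_sum, hp', mul_one, hp]
  · have h1 := (IsLocal.input (n := n) (N := N) (I := I × Ω × Ω') (r := 0)).map
      (fun x => (x.1, x.2.1)) |>.comp hF
    rw [zero_add] at h1
    exact (h1.map₂ (IsLocal.input.map fun x => x.2.2) Prod.mk).comp hF'
  · set A : Set (Fin n → Ω) := {ω | ¬ R G ident inp (F G ident fun v => (inp v, ω v))}
    let A' : (Fin n → Ω) → Set (Fin n → Ω') := fun ω =>
      {ω' | ¬ R' G ident (F G ident fun v => (inp v, ω v))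
        (F' G ident fun v => (F G ident (fun v => (inp v, ω v)) v, ω' v))}
    rw [tapeProb,
        ← (Equiv.arrowProdEquivProdArrow (Fin n) (fun _ => Ω) (fun _ => Ω')).symm.sum_comp,
      Fintype.sum_prod_type]
    calc _ ≤ ∑ ω : Fin n → Ω, ∑ ω' : Fin n → Ω',
          ((if ω ∈ A then ∏ v, p (ident v) (ω v) else 0) * ∏ v, p' (ident v) (ω' v) +
            (∏ v, p (ident v) (ω v)) * (if ω' ∈ A' ω then ∏ v, p' (ident v) (ω' v) else 0)) := by
          refine Finset.sum_le_sum fun ω _ => Finset.sum_le_sum fun ω' _ => ?_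
          split_ifs with h1 h2 h3 h3
          · simp [Finset.prod_mul_distrib, Equiv.arrowProdEquivProdArrow]
          · simp [Finset.prod_mul_distrib, Equiv.arrowProdEquivProdArrow]
          · simp [Finset.prod_mul_distrib, Equiv.arrowProdEquivProdArrow]
          · exact absurd ⟨_, not_not.1 h2, not_not.1 h3⟩ h1
          all_goals exact zero_le
      _ = tapeProb p ident A +
          ∑ ω : Fin n → Ω, (∏ v, p (ident v) (ω v)) * tapeProb p' ident (A' ω) := by
          simp only [Finset.sum_add_distrib, ← Finset.mul_sum, sum_prod_tape hp', mul_one,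
            tapeProb]
          congr!
      _ ≤ δ + ∑ ω : Fin n → Ω, (∏ v, p (ident v) (ω v)) * δ' := by
          gcongr with ω _
          · exact hδ G ident inp
          · exact hδ' G ident _
      _ = δ + δ' := by rw [← Finset.sum_mul, sum_prod_tape hp, one_mul]

/-- A solution for maximal independent sets can be used on `nearGraph`. -/
theorem isDistMIS {T : ℕ}
    (h : Achievable (n := n) (N := N) (I := Unit) (O := Bool) T δ
      (fun G _ _ out => IsMIS G {v | out v = true}))
    {W : SimpleGraph (Fin n) → (Fin n ↪ Fin N) → (Fin n → I) → Set (Fin n)}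
    (hW : IsLocalSet r W) (k : ℕ) (f : I → Prop → O) :
    Achievable (r + k * T) δ (fun G ident inp out =>
      ∃ M, IsDistMIS G k (W G ident inp) M ∧ out = fun v => f (inp v) (v ∈ M)) := by
  obtain ⟨Ω, hΩ, p, F, hp, hF, hδ⟩ := h
  have hW' : IsLocalSet r (fun G (ident : Fin n ↪ Fin N) (inp : Fin n → I × Ω) =>
      W G ident fun v => (inp v).1) := by
    have := (IsLocal.input (n := n) (N := N) (I := I × Ω) (r := 0)).map Prod.fst |>.comp hW
    rwa [zero_add] at this
  have h1 := IsLocal.comp_nearGraph (k := k) hW' (IsLocal.input.map fun x => ((), x.2)) hF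
  have h2 := h1.map₂ (hW'.mono (Nat.le_add_right r (k * T))) fun b P => b = true ∧ P
  refine ⟨Ω, hΩ, p, _, hp, (IsLocal.input.map Prod.fst).map₂ h2 f, fun G ident inp => ?_⟩
  refine (tapeProb_mono p ident ?_).trans
    (hδ (nearGraph G k (W G ident inp)) ident fun _ => ())
  intro ω hω hMIS
  exact hω ⟨_, hMIS.isDistMIS, rfl⟩

end Achievable

section Conversions

variable {n N T : ℕ} {I O : Type} {δ : ℝ≥0∞} {Q : DistributedProblem I O}

/-- The relation that an output is correct if the input is an instance. -/
def problemRel (n N : ℕ) (Q : DistributedProblem I O) : NetworkRel n N I O :=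
  fun G _ inp out => Q.Instance G inp → Q.Correct G inp out

theorem SolvableIn.achievable (h : SolvableIn Q n N T) :
    Achievable T 0 (problemRel n N Q) := by
  obtain ⟨A, hA⟩ := h
  refine (Achievable.of_isLocal (A.isLocal_run T)).imp ?_
  rintro G ident inp _ rfl
  exact hA G ident inp

/-- With error 0, every tape assignment of positive weight is correct, so one tape of positive
weight can be fixed for each identifier. -/
theorem Achievable.solvableIn [Inhabited O] (h : Achievable T 0 (problemRel n N Q)) :
    SolvableIn Q n N T := by
  classical
  obtain ⟨Ω, hΩ, p, F, hp, hF, hδ⟩ := h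
  have hex : ∀ j, ∃ x, p j x ≠ 0 := fun j => by
    by_contra! hcon
    have := hp j
    simp [hcon] at this
  choose x hx using hex
  have h1 : IsLocal T (fun G (ident : Fin n ↪ Fin N) (inp : Fin n → I) =>
      F G ident fun v => (inp v, x (ident v))) := by
    have := (IsLocal.input (n := n) (N := N) (I := I) (r := 0)).map₂
      (IsLocal.ident.map x) Prod.mk |>.comp hF
    rwa [zero_add] at this
  obtain ⟨A, hA⟩ := h1.exists_algorithm
  refine ⟨A, fun G ident inp => ?_⟩
  rw [hA]
  by_contra hcon
  have h0 := (Finset.sum_eq_zero_iff.1 (nonpos_iff_eq_zero.1 (hδ G ident inp)))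
    (fun v => x (ident v)) (Finset.mem_univ _)
  rw [if_pos (Set.mem_ofPred_eq ▸ hcon)] at h0
  exact Finset.prod_ne_zero_iff.2 (fun v _ => hx (ident v)) h0

/-- Identical distribution is restored by letting each node draw a tape for every identifier and
read only the entry of its own. -/
theorem Achievable.randSolvableIn [Inhabited O] (h : Achievable T δ (problemRel n N Q)) :
    RandSolvableIn Q δ n N T := by
  classical
  obtain ⟨Ω, hΩ, p, F, hp, hF, hδ⟩ := h
  let _ : MeasurableSpace Ω := ⊤
  have hprob := fun j => isProbabilityMeasure_pointMasses (hp j)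
  have h1 : IsLocal T (fun G (ident : Fin n ↪ Fin N) (inp : Fin n → I × (Fin N → Ω)) =>
      F G ident fun v => ((inp v).1, (inp v).2 (ident v))) := by
    have := (IsLocal.input (n := n) (N := N) (I := I × (Fin N → Ω)) (r := 0)).map₂
      IsLocal.ident (fun x i => (x.1, x.2 i)) |>.comp hF
    rwa [zero_add] at this
  obtain ⟨A, hA⟩ := h1.exists_algorithm
  refine ⟨Fin N → Ω, inferInstance, Measure.pi fun j => pointMasses Finset.univ (p j),
    inferInstance, A, fun G ident inp hinst => ?_⟩
  simp only [hA]
  have hmeas : Measurable fun (ω : Fin n → Fin N → Ω) v => ω v (ident v) :=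
    measurable_pi_lambda _ fun v => (measurable_pi_apply (ident v)).comp (measurable_pi_apply v)
  have hmap : (Measure.pi fun _ : Fin n => Measure.pi fun j => pointMasses Finset.univ (p j)).map
      (fun ω v => ω v (ident v)) = Measure.pi fun v => pointMasses Finset.univ (p (ident v)) := by
    rw [Measure.pi_map_pi fun v => (measurable_pi_apply (ident v)).aemeasurable]
    congr 1
    ext v : 1
    exact (measurePreserving_eval (fun j => pointMasses Finset.univ (p j)) (ident v)).map_eq
  calc _ = (Measure.pi fun v => pointMasses Finset.univ (p (ident v)))
        {ω | ¬ Q.Correct G inp (F G ident fun v => (inp v, ω v))} := by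
        rw [← hmap, Measure.map_apply hmeas (Set.toFinite _).measurableSet]
        rfl
    _ ≤ δ := by
        rw [pi_pointMasses_apply hp]
        refine (tapeProb_mono p ident ?_).trans (hδ G ident inp)
        exact fun ω hω hR => hω (hR hinst)

/-- There are finitely many instances, so finitely many failure probabilities have to be controlled.
Tapes are indexed by identifiers, since the same distributions must serve every placement of the
identifiers. With `c ^ N ≤ 2` the total loss is a factor 2. -/
theorem RandSolvableIn.achievable [Finite I] (h : RandSolvableIn Q δ n N T) :
    Achievable T (2 * δ) (problemRel n N Q) := by
  classical
  obtain ⟨Ω, _, μ, _, A, hA⟩ := h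
  let J := {x : SimpleGraph (Fin n) × (Fin n ↪ Fin N) × (Fin n → I) // Q.Instance x.1 x.2.2}
  let bad : J → Set (Fin n → Ω) := fun i =>
    {ω | ¬ Q.Correct i.1.1 i.1.2.2 (A.run i.1.1 i.1.2.1 (fun v => (i.1.2.2 v, ω v)) T)}
  -- Failure events need not be measurable; a measurable hull has the same measure.
  let B : J → Set (Fin n → Ω) := fun i => toMeasurable (Measure.pi fun _ => μ) (bad i)
  have hBm : ∀ i, MeasurableSet (B i) := fun i => measurableSet_toMeasurable _ _
  have hcomp : ∀ ident : Fin n ↪ Fin N, Measurable fun (x : Fin N → Ω) v => x (ident v) :=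
    fun ident => measurable_pi_lambda _ fun v => measurable_pi_apply (ident v)
  let B' : J → Set (Fin N → Ω) := fun i => (fun x v => x (i.1.2.1 v)) ⁻¹' B i
  have hB'm : ∀ i, MeasurableSet (B' i) := fun i => hcomp i.1.2.1 (hBm i)
  have hB' : ∀ (ν : Fin N → Measure Ω) [∀ j, IsProbabilityMeasure (ν j)] i,
      Measure.pi ν (B' i) = Measure.pi (fun v => ν (i.1.2.1 v)) (B i) := fun ν _ i => by
    rw [← map_pi_comp_injective ν i.1.2.1.injective, Measure.map_apply (hcomp _) (hBm i)]
  obtain ⟨c, hc1, hc2⟩ : ∃ c : ℝ≥0∞, 1 < c ∧ c ^ Fintype.card (Fin N) ≤ 2 := by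
    rw [Fintype.card_fin]
    rcases Nat.eq_zero_or_pos N with rfl | hN
    · exact ⟨2, by norm_num, by norm_num⟩
    · refine ⟨2 ^ ((N : ℝ)⁻¹), ENNReal.one_lt_rpow (by norm_num) (by positivity), ?_⟩
      rw [← ENNReal.rpow_natCast, ← ENNReal.rpow_mul, inv_mul_cancel₀ (by positivity),
        ENNReal.rpow_one]
  obtain ⟨S, q, hq, hle⟩ := exists_pointMasses_pi (ι := Fin N) μ
    (fun i : J => (B' i).indicator 1) (fun i => measurable_one.indicator (hB'm i))
    (fun i x => Set.indicator_le_self' (by simp) x) hc1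
  have hprob := fun j => isProbabilityMeasure_pointMasses (hq j)
  have hle' : ∀ i : J, Measure.pi (fun v => pointMasses (S (i.1.2.1 v)) (q (i.1.2.1 v))) (B i) ≤
      2 * δ := fun i => by
    have h1 := hle i
    rw [lintegral_indicator_one (hB'm i), lintegral_indicator_one (hB'm i), hB', hB',
      measure_toMeasurable] at h1
    exact h1.trans (mul_le_mul' hc2 (hA _ _ _ i.2))
  let F : Finset Ω := Finset.univ.biUnion S
  let p : Fin N → F → ℝ≥0∞ := fun j x => if x.1 ∈ S j then q j x else 0
  have hsub : ∀ j, S j ⊆ F := fun j => Finset.subset_biUnion_of_mem S (Finset.mem_univ j)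
  have hsum : ∀ {M : Type} [AddCommMonoid M] (j : Fin N) (g : Ω → M),
      ∑ x : F, (if x.1 ∈ S j then g x else 0) = ∑ x ∈ S j, g x := fun j g => by
    rw [Finset.sum_coe_sort F fun x => if x ∈ S j then g x else 0, ← Finset.sum_filter,
      Finset.filter_mem_eq_inter, Finset.inter_eq_right.2 (hsub j)]
  have hp : ∀ j, ∑ x, p j x = 1 := fun j => (hsum j (q j)).trans (hq j)
  have h1 : IsLocal T (fun G (ident : Fin n ↪ Fin N) (inp : Fin n → I × F) =>
      A.run G ident (fun v => ((inp v).1, (inp v).2.1)) T) := by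
    have := (IsLocal.input (n := n) (N := N) (I := I × F) (r := 0)).map
      (fun x => (x.1, x.2.1)) |>.comp (A.isLocal_run T)
    rwa [zero_add] at this
  refine ⟨F, inferInstance, p, _, hp, h1, fun G ident inp => ?_⟩
  by_cases hinst : Q.Instance G inp
  · let i : J := ⟨(G, ident, inp), hinst⟩
    let _ : MeasurableSpace F := ⊤
    have hprob' := fun j => isProbabilityMeasure_pointMasses (hp j)
    have hval : Measurable (Subtype.val : F → Ω) := measurable_from_top
    have hmap : ∀ j, (pointMasses Finset.univ (p j)).map Subtype.val = pointMasses (S j) (q j) := by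
      intro j
      ext E hE
      rw [Measure.map_apply hval hE]
      simp only [pointMasses, Measure.finsetSum_apply, Measure.smul_apply, smul_eq_mul]
      rw [← hsum j]
      refine Finset.sum_congr rfl fun x _ => ?_
      rw [Measure.dirac_apply' _ (hval hE), Measure.dirac_apply' _ hE]
      simp only [p, ite_mul, zero_mul]
      rfl
    rw [← pi_pointMasses_apply hp]
    refine (measure_mono (t := (fun ω v => (ω v).1) ⁻¹' B i) ?_).trans
      (le_trans (le_of_eq ?_) (hle' i))
    · intro ω hω
      apply subset_toMeasurable
      exact fun h => hω fun _ => h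
    · have hmeas : Measurable fun (ω : Fin n → F) v => (ω v).1 :=
        measurable_pi_lambda _ fun v => hval.comp (measurable_pi_apply v)
      rw [← Measure.map_apply hmeas (hBm i), Measure.pi_map_pi fun v => hval.aemeasurable]
      simp only [hmap, i]
  · have : {ω : Fin n → F | ¬ problemRel n N Q G ident inp
        (A.run G ident (fun v => (inp v, (ω v).1)) T)} = ∅ := by
      ext ω
      simp [problemRel, hinst]
    rw [this]
    simp [tapeProb]

end Conversions

end Solvability

/-! ### The eight choices of the plan as a distributed computation -/

section Assembly

/-- The set of the nodes whose `i`-th register holds. -/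
def register {V : Type*} (ρ : V → ℕ → Prop) (i : ℕ) : Set V := {v | ρ v i}

open Classical in
/-- Overwrite the `i`-th register. -/
def setRegister (i : ℕ) (x : ℕ → Prop) (P : Prop) : ℕ → Prop := Function.update x i P

theorem register_setRegister_self {V : Type*} (ρ : V → ℕ → Prop) (i : ℕ) (M : Set V) :
    register (fun v => setRegister i (ρ v) (v ∈ M)) i = M := by
  ext v
  simp [register, setRegister]

theorem register_setRegister_of_ne {V : Type*} (ρ : V → ℕ → Prop) {i j : ℕ} (h : j ≠ i)
    (M : Set V) : register (fun v => setRegister i (ρ v) (v ∈ M)) j = register ρ j := by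
  ext v
  simp [register, setRegister, h]

/-- The sets that the choices of a schedule plan are maximal in; the choices are stored in the
registers from `2` on, after `α` and `β`. -/
def planDomain {V : Type*} (G : SimpleGraph V) (R : ℕ → Set V) : ℕ → Set V
  | 0 => pairable G (R 0) (R 1)
  | 1 => bridgeCandidates G (R 0) (R 2)
  | 2 => uncovered G (R 0) (R 1) (R 2) (R 3)
  | i + 3 => rim G (grown (R 2) (fun j => R (j + 5)) i)

/-- The separation of the `i`-th choice of a schedule plan. -/
def planDistance (i : ℕ) : ℕ := if i = 0 then 5 else 1

theorem grown_congr {V : Type*} {B B' : Set V} {J J' : ℕ → Set V} {i : ℕ} (hB : B = B')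
    (hJ : ∀ j < i, J j = J' j) : grown B J i = grown B' J' i := by
  induction i with
  | zero => exact hB
  | succ i ih => rw [grown, grown, ih fun j hj => hJ j (by omega), hJ i (by omega)]

/-- Choice `i` looks only at registers written before it, so later choices do not invalidate it. -/
theorem planDomain_congr {V : Type*} (G : SimpleGraph V) {R R' : ℕ → Set V} {i : ℕ}
    (h : ∀ j < i + 2, R j = R' j) : planDomain G R i = planDomain G R' i := by
  match i with
  | 0 => rw [planDomain, planDomain, h 0 (by omega), h 1 (by omega)]
  | 1 => rw [planDomain, planDomain, h 0 (by omega), h 2 (by omega)]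
  | 2 => rw [planDomain, planDomain, h 0 (by omega), h 1 (by omega), h 2 (by omega),
      h 3 (by omega)]
  | i + 3 =>
    rw [planDomain, planDomain, grown_congr (h 2 (by omega)) fun j hj => h (j + 5) (by omega)]

/-- The first `m` choices of a schedule plan are correct. -/
def PlanUpTo {V : Type*} (G : SimpleGraph V) (R : ℕ → Set V) (m : ℕ) : Prop :=
  ∀ i < m, IsDistMIS G (planDistance i) (planDomain G R i) (R (i + 2))

theorem PlanUpTo.isSchedulePlan {V : Type*} {G : SimpleGraph V} {R : ℕ → Set V}
    (h : PlanUpTo G R 8) :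
    IsSchedulePlan G (R 0) (R 1) (R 2) (R 3) (R 4) (fun j => R (j + 5)) where
  centers := h 0 (by omega)
  bridges := h 1 (by omega)
  completion := h 2 (by omega)
  increment i hi := h (i + 3) (by omega)

section Locality

variable {n N r : ℕ} {I : Type}
  {α β B X C : SimpleGraph (Fin n) → (Fin n ↪ Fin N) → (Fin n → I) → Set (Fin n)}
  {J : ℕ → SimpleGraph (Fin n) → (Fin n ↪ Fin N) → (Fin n → I) → Set (Fin n)}

theorem IsLocalSet.anchors (hα : IsLocalSet r α) (hB : IsLocalSet r B) :
    IsLocalSet (r + 3) (fun G ident inp => anchors G (α G ident inp) (B G ident inp)) :=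
  ((hα.mono (by omega)).inter (hB.thickening 3)).diff (hB.neighbors.mono (by omega))

theorem IsLocalSet.bridgeCandidates (hα : IsLocalSet r α) (hB : IsLocalSet r B) :
    IsLocalSet (r + 5)
      (fun G ident inp => bridgeCandidates G (α G ident inp) (B G ident inp)) :=
  ((hB.neighbors.mono (by omega)).inter ((hα.anchors hB).thickening 2)).diff
    (((hα.anchors hB).thickening 1).mono (by omega))

theorem IsLocalSet.bridged (hα : IsLocalSet r α) (hB : IsLocalSet r B) (hX : IsLocalSet r X) :
    IsLocalSet (r + 1)
      (fun G ident inp => bridged G (α G ident inp) (B G ident inp) (X G ident inp)) :=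
  (((hα.mono (by omega)).diff hX.neighbors).diff hB.neighbors).union (hX.mono (by omega))

theorem IsLocalSet.insertion (hα : IsLocalSet r α) (hβ : IsLocalSet r β) (hB : IsLocalSet r B)
    (hX : IsLocalSet r X) (k : ℕ) :
    IsLocalSet (r + 2) (fun G ident inp =>
      insertion G (α G ident inp) (β G ident inp) (B G ident inp) (X G ident inp) k) := by
  have h3 := hα.bridged hB hX
  have h4 := (h3.mono (by omega : r + 1 ≤ r + 2)).union
    ((hβ.mono (by omega : r ≤ r + 2)).diff h3.neighbors)
  match k with
  | 0 => exact hα.mono (by omega)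
  | 1 => exact (hα.mono (by omega)).diff (hX.neighbors.mono (by omega))
  | 2 =>
    exact ((hα.mono (by omega)).diff (hX.neighbors.mono (by omega))).union (hX.mono (by omega))
  | 3 => exact h3.mono (by omega)
  | 4 => exact h4
  | k + 5 => exact h4.diff (hX.mono (by omega))

theorem IsLocalSet.uncovered (hα : IsLocalSet r α) (hβ : IsLocalSet r β) (hB : IsLocalSet r B)
    (hX : IsLocalSet r X) :
    IsLocalSet (r + 3) (fun G ident inp =>
      uncovered G (α G ident inp) (β G ident inp) (B G ident inp) (X G ident inp)) :=
  (((hα.insertion hβ hB hX 5).union (hB.mono (by omega))).thickening 1).compl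

theorem IsLocalSet.grown (hB : IsLocalSet r B) (hJ : ∀ i, IsLocalSet r (J i)) (i : ℕ) :
    IsLocalSet r (fun G ident inp =>
      grown (B G ident inp) (fun j => J j G ident inp) i) := by
  induction i with
  | zero => exact hB
  | succ i ih => exact ih.union (hJ i)

theorem IsLocalSet.rim (hB : IsLocalSet r B) :
    IsLocalSet (r + 2) (fun G ident inp => rim G (B G ident inp)) :=
  (hB.thickening 2).diff ((hB.thickening 1).mono (by omega))

theorem IsLocalSet.replacement {S : SimpleGraph (Fin n) → (Fin n ↪ Fin N) → (Fin n → I) →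
    Set (Fin n)} (hB : IsLocalSet r B) (hJ : ∀ i, IsLocalSet r (J i)) (hS : IsLocalSet r S)
    (j : ℕ) :
    IsLocalSet (r + 1) (fun G ident inp =>
      replacement G (B G ident inp) (fun j => J j G ident inp) (S G ident inp) j) :=
  ((hS.mono (by omega)).diff (hB.grown hJ _).neighbors).union
    ((hB.grown hJ _).mono (by omega))

theorem IsLocalSet.schedule (hα : IsLocalSet r α) (hβ : IsLocalSet r β) (hB : IsLocalSet r B)
    (hX : IsLocalSet r X) (hC : IsLocalSet r C) (hJ : ∀ i, IsLocalSet r (J i)) (k : ℕ) :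
    IsLocalSet (r + 3) (fun G ident inp => schedule G (α G ident inp) (β G ident inp)
      (B G ident inp) (X G ident inp) (C G ident inp) (fun j => J j G ident inp) k) := by
  have h2 : r ≤ r + 2 := by omega
  unfold MISReconfig.schedule
  split_ifs
  · exact (hα.insertion hβ hB hX k).mono (by omega)
  · exact (hB.mono h2).replacement (fun i => (hJ i).mono h2)
      (((hα.insertion hβ hB hX 5).union (hB.mono h2)).union (hC.mono h2)) _
  · exact (hB.grown hJ 5).mono (by omega)
  · exact (hB.replacement hJ hβ _).mono (by omega)

theorem isLocalSet_register (i : ℕ) :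
    IsLocalSet (n := n) (N := N) 0 (fun _ _ inp => register inp i) :=
  IsLocal.input.map fun x : ℕ → Prop => x i

theorem isLocalSet_planDomain (i : ℕ) :
    IsLocalSet (n := n) (N := N) 5 (fun G _ inp => planDomain G (register inp) i) := by
  match i with
  | 0 => exact ((isLocalSet_register 0).pairable (isLocalSet_register 1)).mono (by omega)
  | 1 => exact ((isLocalSet_register 0).bridgeCandidates (isLocalSet_register 2)).mono (by omega)
  | 2 =>
    exact ((isLocalSet_register 0).uncovered (isLocalSet_register 1) (isLocalSet_register 2)
      (isLocalSet_register 3)).mono (by omega)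
  | i + 3 =>
    exact (((isLocalSet_register 2).grown (J := fun j _ _ inp => register inp (j + 5))
      (fun j => isLocalSet_register (j + 5)) i).rim).mono (by omega)

end Locality

section Composition

variable {n N T : ℕ} {δ : ℝ≥0∞}

/-- Each choice costs 5 rounds to recognize its domain and at most `5 * T` to simulate the MIS
algorithm there. -/
theorem achievable_planUpTo (h : Achievable T δ (problemRel n N misProblem)) (m : ℕ) :
    Achievable (m * (5 + 5 * T)) (m * δ)
      (fun (G : SimpleGraph (Fin n)) (_ : Fin n ↪ Fin N) inp out =>
        register out 0 = register inp 0 ∧ register out 1 = register inp 1 ∧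
          PlanUpTo G (register out) m) := by
  induction m with
  | zero =>
    have h0 := Achievable.of_isLocal (n := n) (N := N)
      (IsLocal.input (n := n) (N := N) (I := ℕ → Prop) (r := 0))
    simp only [Nat.cast_zero, zero_mul]
    refine h0.imp ?_
    rintro G ident inp _ rfl
    exact ⟨rfl, rfl, fun i hi => absurd hi (by omega)⟩
  | succ m ih =>
    have h1 : Achievable (n := n) (N := N) T δ
        (fun G _ (_ : Fin n → Unit) out => IsMIS G {v | out v = true}) :=
      h.imp fun G _ _ _ hR => hR trivial
    have h2 := (h1.isDistMIS (isLocalSet_planDomain m) (planDistance m)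
      (setRegister (m + 2))).mono (s := 5 + 5 * T) (by
        have : planDistance m ≤ 5 := by unfold planDistance; split_ifs <;> omega
        gcongr)
    rw [show (m + 1) * (5 + 5 * T) = m * (5 + 5 * T) + (5 + 5 * T) by ring,
      show ((m + 1 : ℕ) : ℝ≥0∞) * δ = m * δ + δ by push_cast; ring]
    refine (ih.comp h2).imp ?_
    rintro G ident inp _ ⟨mid, ⟨h3, h4, h5⟩, M, hM, rfl⟩
    have hne : ∀ j < m + 2, register (fun v => setRegister (m + 2) (mid v) (v ∈ M)) j =
        register mid j := fun j hj => register_setRegister_of_ne mid (by omega) M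
    refine ⟨(hne 0 (by omega)).trans h3, (hne 1 (by omega)).trans h4, fun i hi => ?_⟩
    rw [planDomain_congr G fun j hj => hne j (by omega)]
    obtain hi | rfl := Nat.lt_succ_iff_lt_or_eq.1 hi
    · rw [hne _ (by omega)]
      exact h5 i hi
    · rwa [register_setRegister_self]

open Classical in
/-- The schedule that is determined by the choices in the registers. -/
noncomputable def scheduleMap (n N : ℕ) : NetworkMap n N (ℕ → Prop) (Fin (28 + 1) → Bool) :=
  fun G _ inp v k => decide (v ∈ schedule G (register inp 0) (register inp 1) (register inp 2)
    (register inp 3) (register inp 4) (fun j => register inp (j + 5)) k)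

theorem isLocal_scheduleMap : IsLocal 3 (scheduleMap n N) := by
  classical
  have h : ∀ k : Fin (28 + 1), IsLocalSet (n := n) (N := N) 3 (fun G _ inp =>
      schedule G (register inp 0) (register inp 1) (register inp 2) (register inp 3)
        (register inp 4) (fun j => register inp (j + 5)) k) := fun k =>
    ((isLocalSet_register 0).schedule (J := fun j _ _ inp => register inp (j + 5))
      (isLocalSet_register 1) (isLocalSet_register 2) (isLocalSet_register 3)
      (isLocalSet_register 4) (fun j => isLocalSet_register (j + 5)) k).mono (by omega)
  exact IsLocal.pi fun k => (h k).map fun P => decide P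

/-- Load the inputs `α` and `β` into the registers. -/
def loadRegisters (x : Bool × Bool) : ℕ → Prop
  | 0 => x.1 = true
  | 1 => x.2 = true
  | _ => False

/-- The eight choices are `B`, `X`, `C` and five increments; 3 further rounds evaluate the schedule.
-/
theorem achievable_reconfiguration (h : Achievable T δ (problemRel n N misProblem)) :
    Achievable (43 + 40 * T) (8 * δ) (problemRel n N (reconfigurationProblem 28)) := by
  have h1 := Achievable.of_isLocal (n := n) (N := N) ((IsLocal.input (r := 0)).map loadRegisters)
  have h2 := (h1.comp (achievable_planUpTo h 8)).comp
    (Achievable.of_isLocal (isLocal_scheduleMap (n := n) (N := N)))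
  rw [show 0 + 8 * (5 + 5 * T) + 3 = 43 + 40 * T by ring, zero_add, add_zero, Nat.cast_ofNat] at h2
  refine h2.imp ?_
  rintro G ident inp _ ⟨mid, ⟨_, rfl, h3, h4, h5⟩, rfl⟩ ⟨hG, hd, hα, hβ⟩
  have hplan := h5.isSchedulePlan
  rw [h3, h4] at hplan
  have := hplan.isReconfigurationSchedule hG hd hα hβ
  simp only [reconfigurationProblem, scheduleMap, h3, h4, decide_eq_true_eq]
  exact this

end Composition

/-! ### Absorbing the additive constant -/

section Complexity

variable {n N : ℕ} {δ : ℝ≥0∞}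

theorem complexity_eq_top_or {I O : Type} (Q : DistributedProblem I O) (n N : ℕ) :
    complexity Q n N = ⊤ ∨ ∃ T : ℕ, SolvableIn Q n N T ∧ complexity Q n N = T := by
  classical
  by_cases h : ∃ T, SolvableIn Q n N T
  · refine Or.inr ⟨Nat.find h, Nat.find_spec h, le_antisymm (iInf₂_le _ (Nat.find_spec h)) ?_⟩
    exact le_iInf₂ fun T hT => by exact_mod_cast Nat.find_min' h hT
  · left
    push Not at h
    simp [complexity, h]

theorem randComplexity_eq_top_or {I O : Type} (Q : DistributedProblem I O) (δ : ℝ≥0∞)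
    (n N : ℕ) : randComplexity Q δ n N = ⊤ ∨
      ∃ T : ℕ, RandSolvableIn Q δ n N T ∧ randComplexity Q δ n N = T := by
  classical
  by_cases h : ∃ T, RandSolvableIn Q δ n N T
  · refine Or.inr ⟨Nat.find h, Nat.find_spec h, le_antisymm (iInf₂_le _ (Nat.find_spec h)) ?_⟩
    exact le_iInf₂ fun T hT => by exact_mod_cast Nat.find_min' h hT
  · left
    push Not at h
    simp [randComplexity, h]

/-- Without communication, the nodes cannot tell the empty graph from the complete graph. -/
theorem not_isMIS_bot_and_top (hn : 2 ≤ n) (S : Set (Fin n)) :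
    ¬ (IsMIS (⊥ : SimpleGraph (Fin n)) S ∧ IsMIS (⊤ : SimpleGraph (Fin n)) S) := by
  rintro ⟨h1, h2⟩
  have hmem : ∀ v, v ∈ S := fun v => by
    obtain ⟨s, hs, hvs⟩ := h1.dominating v
    rcases near_one.1 hvs with h | rfl
    · exact absurd h (by simp)
    · exact hs
  have hne : (⟨0, by omega⟩ : Fin n) ≠ ⟨1, by omega⟩ := by simp
  exact h2.indep _ (hmem _) _ (hmem _) ((SimpleGraph.top_adj _ _).2 hne)

theorem not_solvableIn_mis_zero (hn : 2 ≤ n) (ident : Fin n ↪ Fin N) :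
    ¬ SolvableIn misProblem n N 0 := by
  rintro ⟨A, hA⟩
  exact not_isMIS_bot_and_top hn _
    ⟨hA ⊥ ident (fun _ => ()) trivial, hA ⊤ ident (fun _ => ()) trivial⟩

/-- Without communication each tape gives the same output on the empty and the complete graph, so
the two failure events cover the whole space. -/
theorem one_le_of_randSolvableIn_mis_zero (hn : 2 ≤ n) (ident : Fin n ↪ Fin N)
    (h : RandSolvableIn misProblem δ n N 0) : 1 ≤ 2 * δ := by
  obtain ⟨Ω, _, μ, _, A, hA⟩ := h
  have h1 := hA ⊥ ident (fun _ => ()) trivial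
  have h2 := hA ⊤ ident (fun _ => ()) trivial
  calc (1 : ℝ≥0∞) = Measure.pi (fun _ : Fin n => μ) Set.univ := by simp
    _ ≤ Measure.pi (fun _ : Fin n => μ) (_ ∪ _) := measure_mono fun ω _ => by
        by_contra hcon
        rw [Set.mem_union, not_or] at hcon
        exact not_isMIS_bot_and_top hn _ ⟨not_not.1 hcon.1, not_not.1 hcon.2⟩
    _ ≤ _ := measure_union_le _ _
    _ ≤ δ + δ := add_le_add h1 h2
    _ = 2 * δ := (two_mul δ).symm

theorem two_le_of_instance {G : SimpleGraph (Fin n)} {inp : Fin n → Bool × Bool}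
    (h : (reconfigurationProblem 28).Instance G inp) : 2 ≤ n := by
  have : Nontrivial (Fin n) := SimpleGraph.nontrivial_of_diam_ne_zero (G := G) (by
    have := h.2.1
    omega)
  exact Fin.nontrivial_iff_two_le.1 this

theorem achievable_zero_of_forall {I O : Type} [Inhabited O] {R : NetworkRel n N I O}
    (h : ∀ G ident inp out, R G ident inp out) : Achievable 0 0 R :=
  (Achievable.of_isLocal ((IsLocal.ident (I := I)).map fun _ => default)).imp
    fun G ident inp out _ => h G ident inp out

theorem solvableIn_zero_of_mis_zero (h : SolvableIn misProblem n N 0) :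
    SolvableIn (reconfigurationProblem 28) n N 0 :=
  (achievable_zero_of_forall fun _ ident _ _ hinst =>
    absurd h (not_solvableIn_mis_zero (two_le_of_instance hinst) ident)).solvableIn

theorem randSolvableIn_of_one_le {I O : Type} [Inhabited O] (Q : DistributedProblem I O)
    (hδ : 1 ≤ δ) (n N T : ℕ) : RandSolvableIn Q δ n N T :=
  ⟨Unit, ⊤, Measure.dirac (), inferInstance, ⟨Unit, Unit, fun _ _ => (), fun _ _ => (),
    fun _ _ => (), fun _ => default⟩, fun _ _ _ _ => prob_le_one.trans hδ⟩

/-- Either the allowed error reaches 1, or there is no network with at least two nodes and hence no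
instance. -/
theorem randSolvableIn_zero_of_mis_zero (h : RandSolvableIn misProblem δ n N 0) {C : ℝ≥0∞}
    (hC : 2 ≤ C) : RandSolvableIn (reconfigurationProblem 28) (C * δ) n N 0 := by
  by_cases hn : 2 ≤ n ∧ Nonempty (Fin n ↪ Fin N)
  · obtain ⟨hn, ⟨ident⟩⟩ := hn
    refine randSolvableIn_of_one_le _ ?_ n N 0
    exact (one_le_of_randSolvableIn_mis_zero hn ident h).trans (by gcongr)
  · refine ((achievable_zero_of_forall fun _ ident _ _ hinst =>
      absurd ⟨two_le_of_instance hinst, ⟨ident⟩⟩ hn).mono_error zero_le).randSolvableIn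

theorem complexity_reconfiguration_le (n N : ℕ) :
    complexity (reconfigurationProblem 28) n N ≤ 83 * complexity misProblem n N := by
  rcases complexity_eq_top_or misProblem n N with h | ⟨T, hT, h⟩
  · rw [h, ENat.mul_top (by norm_num)]
    exact le_top
  · rw [h]
    rcases Nat.eq_zero_or_pos T with rfl | hpos
    · exact (iInf₂_le 0 (solvableIn_zero_of_mis_zero hT)).trans (by simp)
    · have h1 := achievable_reconfiguration hT.achievable
      rw [mul_zero] at h1
      refine (iInf₂_le _ h1.solvableIn).trans ?_
      -- The constant 83 = 43 + 40 comes from `T ≥ 1`.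
      exact_mod_cast (by omega : 43 + 40 * T ≤ 83 * T)

theorem randComplexity_reconfiguration_le (δ : ℝ≥0∞) (n N : ℕ) :
    randComplexity (reconfigurationProblem 28) (83 * δ) n N ≤
      83 * randComplexity misProblem δ n N := by
  rcases randComplexity_eq_top_or misProblem δ n N with h | ⟨T, hT, h⟩
  · rw [h, ENat.mul_top (by norm_num)]
    exact le_top
  · rw [h]
    rcases Nat.eq_zero_or_pos T with rfl | hpos
    · exact (iInf₂_le 0 (randSolvableIn_zero_of_mis_zero hT (by norm_num))).trans (by simp)
    · have h1 : Achievable (43 + 40 * T) (83 * δ)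
          (problemRel n N (reconfigurationProblem 28)) :=
        -- Eight choices with error `2 * δ` each give `16 * δ`, well below `83 * δ`.
        (achievable_reconfiguration hT.achievable).mono_error (by
          rw [← mul_assoc]
          gcongr
          norm_num)
      refine (iInf₂_le _ h1.randSolvableIn).trans ?_
      exact_mod_cast (by omega : 43 + 40 * T ≤ 83 * T)

end Complexity

end Assembly

end MISReconfig

theorem theorem2 :
    (∀ (V : Type*) [Finite V] (G : SimpleGraph V) (α β : Set V),
      G.Connected → 3 < G.diam → MISReconfig.IsMIS G α → MISReconfig.IsMIS G β →
      ∃ S : Fin (28 + 1) → Set V,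
        MISReconfig.IsReconfigurationSchedule G
          (fun H U => MISReconfig.IsRulingSet H 2 4 U) α β 28 S) ∧
    ∃ C : ℕ, ∀ n N : ℕ,
      MISReconfig.complexity (MISReconfig.reconfigurationProblem 28) n N ≤
        (C : ℕ∞) * (MISReconfig.complexity MISReconfig.misProblem n N +
          MISReconfig.complexity (MISReconfig.rulingSetProblem 3 2) n N) ∧
      ∀ δ : ℝ≥0∞,
        MISReconfig.randComplexity (MISReconfig.reconfigurationProblem 28) ((C : ℝ≥0∞) * δ) n N ≤
          (C : ℕ∞) * (MISReconfig.randComplexity MISReconfig.misProblem δ n N +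
            MISReconfig.randComplexity (MISReconfig.rulingSetProblem 3 2) δ n N) := by
  refine ⟨fun V _ G α β hG hd hα hβ => ?_, 83, fun n N => ⟨?_, fun δ => ?_⟩⟩
  · obtain ⟨B, X, C, J, h⟩ := MISReconfig.exists_isSchedulePlan G α β
    exact ⟨_, h.isReconfigurationSchedule hG hd hα hβ⟩
  · exact (MISReconfig.complexity_reconfiguration_le n N).trans
      (mul_le_mul_right le_self_add _)
  · exact (MISReconfig.randComplexity_reconfiguration_le δ n N).trans
      (mul_le_mul_right le_self_add _)
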